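/- Let $\mathcal T$ be a Galton--Watson (branching process) tree with root $\varnothing$ and i.i.d. offspring numbers distributed as $X$, where $X\ge 1$ almost surely and $\mathbb P(X>x)=c\,x^{-\alpha}(1+o(1))$ as $x\to\infty$ for some $\alpha>0$, $c>0$. Independently of the tree, give the edges i.i.d. weights $w(e)$ that are uniform on $[0,1]$. Invasion percolation starts from $T_0=\{\varnothing\}$ and at each step adds the vertex outside the current subtree that is joined to it by the edge of smallest weight; let $T=\bigcup_n T_n$ be the invasion percolation cluster. Almost surely $T$ contains exactly one infinite path $(v_i)_{i\ge0}$ from $v_0=\varnothing$, called the backbone. Let $\beta_i$ be the weight of the edge $\{v_{i-1},v_i\}$, and let $W_k=\max_{i>k}\beta_i$ be the future maximum weight. Let $\mathcal M_k$ be the component of the root in $T$ after removing the edge $\{v_k,v_{k+1}\}$, let $C_k=\sum_{e\in E(\mathcal M_k)}w(e)$, and put $\mathcal M_{-1}=\emptyset$, $C_{-1}=0$, $\beta_0=0$. For $k\ge0$ let $\mathcal H_k=(\mathcal M_k\setminus\mathcal M_{k-1})\setminus\{v_k\}$ be the forest that hangs off the backbone vertex $v_k$; its edges are the edges that join its vertices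 to their parents. Let $H_k=|\mathcal H_k|$, which is the number of these edges, and let $B_k=C_k-C_{k-1}-\beta_k$, the cumulative weight attached to $v_k$. Then, for every $k\ge0$, the forest $\mathcal H_k$ is almost surely finite, and conditionally on $W_k=w_k$ and on the forest $\mathcal H_k$ (as a set of vertices of the tree, labelled by Ulam--Harris words), the weights of the $H_k$ edges of $\mathcal H_k$ are i.i.d. uniform on $[0,w_k]$. Consequently, conditionally on $W_k=w_k$, $$B_k \overset{d}{=} \sum_{i=1}^{H_k} U_i,$$ where, conditionally on $W_k=w_k$, the $U_i$ are i.i.d. uniform on $[0,w_k]$ and independent of $H_k$. -/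

import Mathlib

open MeasureTheory ProbabilityTheory Filter Topology

/-!
Vertices are Ulam-Harris words, written with the youngest letter first: `[]` is the root, the
children of `v` are the words `i :: v`, and the ancestors of `v` (with `v` itself) are its suffixes.
A realisation of the weighted tree consists of offspring numbers `x v` and of weights `w v`, where
`w v` is the weight of the edge between the vertex `v ≠ []` and its parent.
-/

namespace InvasionPercolation

/-- The vertex set of the tree in which `v` has the children `i :: v`, `i < x v`. -/
def treeVertices (x : List ℕ → ℕ) : Set (List ℕ) :=
  {v | ∀ (i : ℕ) (u : List ℕ), (i :: u) <:+ v → i < x u}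

/-- The vertices of the tree outside `S` whose parent lies in `S`. -/
def boundary (x : List ℕ → ℕ) (S : Set (List ℕ)) : Set (List ℕ) :=
  {v | v ∈ treeVertices x ∧ v ∉ S ∧ ∃ (i : ℕ) (u : List ℕ), u ∈ S ∧ v = i :: u}

/-- The cluster after `n` steps of invasion percolation: each step adds the boundary vertex of
minimal edge weight. (If several boundary vertices were minimal, all of them would be added; for
i.i.d. uniform weights such a tie has probability zero.) -/
def invaded (x : List ℕ → ℕ) (w : List ℕ → ℝ) : ℕ → Set (List ℕ)
  | 0 => {[]}
  | n + 1 => invaded x w n ∪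
      {v | v ∈ boundary x (invaded x w n) ∧ ∀ u ∈ boundary x (invaded x w n), w v ≤ w u}

/-- The invasion percolation cluster (IPC). -/
def cluster (x : List ℕ → ℕ) (w : List ℕ → ℝ) : Set (List ℕ) :=
  ⋃ n, invaded x w n

/-- `b` is a path from the root to infinity inside the IPC. -/
def IsBackbone (x : List ℕ → ℕ) (w : List ℕ → ℝ) (b : ℕ → List ℕ) : Prop :=
  b 0 = [] ∧ (∀ k, ∃ i : ℕ, b (k + 1) = i :: b k) ∧ ∀ k, b k ∈ cluster x w

/-- The path to infinity in the IPC (meaningful when there is exactly one). -/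
noncomputable def backbone (x : List ℕ → ℕ) (w : List ℕ → ℝ) : ℕ → List ℕ :=
  Classical.epsilon (IsBackbone x w)

/-- The future maximum weight: the largest weight on the backbone beyond its `k`-th vertex (a supremum
of a nonempty set of numbers in `[0, 1]`, which is the maximum whenever the maximum exists). -/
noncomputable def futureMax (x : List ℕ → ℕ) (w : List ℕ → ℝ) (k : ℕ) : ℝ :=
  sSup {β | ∃ i, k < i ∧ β = w (backbone x w i)}

/-- The vertices of the `k`-cut IPC: the component of the root after the edge between the `k`-th
and the `(k+1)`-st backbone vertex is cut. -/
def cut (x : List ℕ → ℕ) (w : List ℕ → ℝ) (k : ℕ) : Set (List ℕ) :=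
  {v | v ∈ cluster x w ∧ ¬ backbone x w (k + 1) <:+ v}

/-- The total edge weight of the `k`-cut IPC; an edge is named by its endpoint away from the
root. -/
noncomputable def cutWeight (x : List ℕ → ℕ) (w : List ℕ → ℝ) (k : ℕ) : ℝ :=
  ∑ᶠ v ∈ cut x w k \ {[]}, w v

/-- The forest hanging off the `k`-th backbone vertex: the vertices by which the `k`-cut IPC
exceeds the `(k-1)`-cut IPC, apart from the `k`-th backbone vertex itself. The edges of the forest
are the edges from its vertices to their parents. -/
def forest (x : List ℕ → ℕ) (w : List ℕ → ℝ) : ℕ → Set (List ℕ)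
  | 0 => cut x w 0 \ {backbone x w 0}
  | k + 1 => (cut x w (k + 1) \ cut x w k) \ {backbone x w (k + 1)}

/-- The number of edges of the forest hanging off the `k`-th backbone vertex. -/
noncomputable def forestSize (x : List ℕ → ℕ) (w : List ℕ → ℝ) (k : ℕ) : ℕ :=
  (forest x w k).ncard

/-- The cumulative weight attached to the `k`-th backbone vertex: the increment of the total weight
from the `(k-1)`-cut to the `k`-cut IPC, without the backbone edge that leads to the `k`-th backbone
vertex. -/
noncomputable def attachedWeight (x : List ℕ → ℕ) (w : List ℕ → ℝ) : ℕ → ℝ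
  | 0 => cutWeight x w 0
  | k + 1 => cutWeight x w (k + 1) - cutWeight x w k - w (backbone x w (k + 1))

/-- The uniform distribution on `[0, a]`. -/
noncomputable def unif (a : ℝ) : Measure ℝ :=
  ProbabilityTheory.cond volume (Set.Icc 0 a)

/-- The law of the sum of `n` independent random variables that are uniform on `[0, a]`. -/
noncomputable def unifSum (a : ℝ) (n : ℕ) : Measure ℝ :=
  (Measure.pi fun _ : Fin n => unif a).map fun u => ∑ i, u i

/-- `X` and `U` are the offspring numbers and the edge weights of a branching process tree with
offspring law `ν` and i.i.d. standard uniform weights, independent of the tree. -/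
structure IsWeightedBPTree {Ω : Type*} [MeasurableSpace Ω] (P : Measure Ω) (ν : Measure ℕ)
    (X : Ω → List ℕ → ℕ) (U : Ω → List ℕ → ℝ) : Prop where
  measurable_offspring : ∀ v, Measurable fun ω => X ω v
  measurable_weight : ∀ v, Measurable fun ω => U ω v
  law : ∀ v, P.map (fun ω => (X ω v, U ω v)) = ν.prod (unif 1)
  indep : iIndepFun (fun v ω => (X ω v, U ω v)) P

/-- `ν` is a power-law offspring distribution `1 - F(x) = c x^{-α} (1 + o(1))` on `{1, 2, …}`. -/
structure IsPowerLawOffspring (ν : Measure ℕ) (α c : ℝ) : Prop where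
  exponent_pos : 0 < α
  constant_pos : 0 < c
  zero_null : ν {0} = 0
  tail : Tendsto (fun x : ℝ => ν.real {n : ℕ | x < n} / (c * x ^ (-α))) atTop (𝓝 1)

end InvasionPercolation

open InvasionPercolation

/-!
Let the threshold of a vertex `v` be the smallest level `p` at which an infinite descending path
of edges with weights at most `p` starts at `v`. Once invasion has reached `v`, it never needs an
edge below `v` heavier than this level. Hence the backbone moves from each vertex to the child
whose branch (the joining edge together with the subtree) has the smallest threshold, `W_k` is the
threshold of the branch through `v_{k+1}`, and `H_k` consists of the vertices joined to `v_k` by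
edges lighter than `W_k` outside that branch.

For fixed words `u`, `j :: u` and a fixed finite set `F`, the event `v_k = u`, `v_{k+1} = j :: u`,
`H_k = F` is therefore an event not involving the weights on `F`, intersected with the event that
each of these weights is less than `W_k`, which does not depend on them either. Independent uniform
variables conditioned to be less than `a` are independent and uniform on `[0, a]`.

This needs that no two branches at a vertex have the same threshold, which holds almost surely
since the law of the threshold has no atoms, unless all vertices have one child. Indeed, the
probability that a vertex has threshold at most `p` is the largest fixed point in `[0, 1]` of
`t ↦ 1 - f (1 - p t)`, where `f` is the generating function of the offspring law. Strict concavity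
of this function excludes a jump of the largest fixed point.
-/

open scoped ENNReal

namespace InvasionPercolation

section

variable {x : List ℕ → ℕ} {w w' : List ℕ → ℝ}

/-! ### Ancestors and open paths -/

theorem not_cons_suffix_of_suffix {i : ℕ} {u v : List ℕ} (h : u <:+ v) : ¬ i :: v <:+ u :=
  fun h' => by simpa using (h'.trans h).length_le

theorem suffix_of_suffix_cons_of_ne {i : ℕ} {u v : List ℕ} (h : u <:+ i :: v)
    (hne : i :: v ≠ u) : u <:+ v :=
  (List.suffix_cons_iff.1 h).resolve_left hne.symm

theorem eq_of_cons_suffix {i j : ℕ} {u v : List ℕ} (hi : i :: u <:+ v) (hj : j :: u <:+ v) :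
    i = j :=
  (List.cons.inj <| (List.suffix_of_suffix_length_le hi hj (by simp)).eq_of_length (by simp)).1

theorem exists_cons_suffix {u v : List ℕ} (h : u <:+ v) (hne : v ≠ u) : ∃ i, i :: u <:+ v := by
  obtain ⟨t, rfl⟩ := h
  rcases List.eq_nil_or_concat t with rfl | ⟨t', i, rfl⟩
  · simp at hne
  · exact ⟨i, t', by simp⟩

theorem forall_cons_suffix_cons_iff {r : ℕ → List ℕ → Prop} {j : ℕ} {v : List ℕ} :
    (∀ i z, i :: z <:+ j :: v → r i z) ↔ (∀ i z, i :: z <:+ v → r i z) ∧ r j v := by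
  refine ⟨fun h => ⟨fun i z hz => h i z (hz.trans (List.suffix_cons j v)), h j v List.suffix_rfl⟩,
    fun ⟨h, hj⟩ i z hz => ?_⟩
  rcases List.suffix_cons_iff.1 hz with heq | hz
  · obtain ⟨rfl, rfl⟩ := List.cons.inj heq
    exact hj
  · exact h i z hz

theorem cons_mem_treeVertices {i : ℕ} {v : List ℕ} :
    i :: v ∈ treeVertices x ↔ v ∈ treeVertices x ∧ i < x v :=
  forall_cons_suffix_cons_iff

theorem nil_mem_treeVertices : [] ∈ treeVertices x := fun i u h => by simp at h

/-- `v` is a child of `u`, and the weight of the edge between them lies in `I`. -/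
def OpenEdge (x : List ℕ → ℕ) (w : List ℕ → ℝ) (I : Set EReal) (u v : List ℕ) : Prop :=
  ∃ i < x u, v = i :: u ∧ (w v : EReal) ∈ I

/-- A descending path leads from `u` to `v` all of whose edges have weights in `I`. -/
def OpenPath (x : List ℕ → ℕ) (w : List ℕ → ℝ) (I : Set EReal) : List ℕ → List ℕ → Prop :=
  Relation.ReflTransGen (OpenEdge x w I)

namespace OpenPath

variable {I : Set EReal} {u v : List ℕ}

theorem suffix (h : OpenPath x w I u v) : u <:+ v := by
  induction h with
  | refl => exact List.suffix_rfl
  | tail _ he ih =>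
    obtain ⟨i, -, rfl, -⟩ := he
    exact ih.trans (List.suffix_cons i _)

theorem exists_exit (h : OpenPath x w I u v) {S : Set (List ℕ)} (hu : u ∈ S) (hv : v ∉ S) :
    ∃ i z, z ∈ S ∧ i < x z ∧ i :: z ∉ S ∧ (w (i :: z) : EReal) ∈ I := by
  induction h with
  | refl => exact absurd hu hv
  | @tail z v _ he ih =>
    by_cases hzS : z ∈ S
    · obtain ⟨i, hi, rfl, hI⟩ := he
      exact ⟨i, z, hzS, hi, hv, hI⟩
    · exact ih hzS

theorem mono {J : Set EReal} (h : OpenPath x w I u v) (hIJ : I ⊆ J) : OpenPath x w J u v :=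
  Relation.ReflTransGen.mono (fun _ _ ⟨i, hi, he, hI⟩ => ⟨i, hi, he, hIJ hI⟩) _ _ h

theorem exists_lt {θ : EReal} (h : OpenPath x w (Set.Iio θ) u v) (hθ : ⊥ < θ) :
    ∃ p < θ, OpenPath x w (Set.Iic p) u v := by
  induction h with
  | refl => exact ⟨⊥, hθ, .refl⟩
  | @tail z v _ he ih =>
    obtain ⟨p, hp, hz⟩ := ih
    obtain ⟨i, hi, rfl, hlt⟩ := he
    exact ⟨max p (w (i :: z)), max_lt hp hlt,
      .tail (mono hz (Set.Iic_subset_Iic.2 (le_max_left _ _)))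
        ⟨i, hi, rfl, Set.mem_Iic.2 (le_max_right _ _)⟩⟩

end OpenPath

/-! ### Percolation thresholds -/

/-- The smallest level `p` at which `v` is the start of a descending path of length `n` all of whose
edges have weight at most `p`. -/
noncomputable def thresholdAux (x : List ℕ → ℕ) (w : List ℕ → ℝ) : ℕ → List ℕ → EReal
  | 0, _ => ⊥
  | n + 1, v => (Finset.range (x v)).inf fun i =>
      max (w (i :: v) : EReal) (thresholdAux x w n (i :: v))

/-- The percolation threshold of the subtree of the descendants of `v`. -/
noncomputable def threshold (x : List ℕ → ℕ) (w : List ℕ → ℝ) (v : List ℕ) : EReal :=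
  ⨆ n, thresholdAux x w n v

/-- The percolation threshold of the branch that consists of `v`, its descendants, and the edge that
leads to `v`. -/
noncomputable def branchThreshold (x : List ℕ → ℕ) (w : List ℕ → ℝ) (v : List ℕ) : EReal :=
  max (w v : EReal) (threshold x w v)

theorem thresholdAux_le_succ (n : ℕ) (v : List ℕ) :
    thresholdAux x w n v ≤ thresholdAux x w (n + 1) v := by
  induction n generalizing v with
  | zero => exact bot_le
  | succ n ih =>
    rw [thresholdAux, thresholdAux]
    exact Finset.inf_mono_fun fun i _ => max_le_max le_rfl (ih _)

theorem thresholdAux_mono (v : List ℕ) : Monotone fun n => thresholdAux x w n v :=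
  monotone_nat_of_le_succ fun n => thresholdAux_le_succ n v

theorem thresholdAux_le_threshold (n : ℕ) (v : List ℕ) :
    thresholdAux x w n v ≤ threshold x w v :=
  le_iSup (fun n => thresholdAux x w n v) n

theorem threshold_eq_inf (v : List ℕ) :
    threshold x w v = (Finset.range (x v)).inf fun i => branchThreshold x w (i :: v) := by
  refine le_antisymm (iSup_le fun n => (thresholdAux_le_succ n v).trans
    (Finset.inf_mono_fun fun i _ => max_le_max le_rfl (thresholdAux_le_threshold _ _))) ?_
  by_contra! h
  have hchild : ∀ i ∈ Finset.range (x v), ∃ n, threshold x w v <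
      max (w (i :: v) : EReal) (thresholdAux x w n (i :: v)) := by
    intro i hi
    rcases lt_max_iff.1 ((Finset.lt_inf_iff (h.trans_le le_top)).1 h i hi) with h | h
    · exact ⟨0, lt_max_of_lt_left h⟩
    · obtain ⟨n, hn⟩ := lt_iSup_iff.1 h
      exact ⟨n, lt_max_of_lt_right hn⟩
  choose! N hN using hchild
  have hlt : threshold x w v < thresholdAux x w ((Finset.range (x v)).sup N + 1) v := by
    rw [thresholdAux, Finset.lt_inf_iff (h.trans_le le_top)]
    exact fun i hi => (hN i hi).trans_le
      (max_le_max le_rfl (thresholdAux_mono _ (Finset.le_sup (f := N) hi)))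
  exact hlt.not_ge (thresholdAux_le_threshold _ _)

theorem threshold_le_branchThreshold {i : ℕ} {v : List ℕ} (hi : i < x v) :
    threshold x w v ≤ branchThreshold x w (i :: v) := by
  rw [threshold_eq_inf]
  exact Finset.inf_le (Finset.mem_range.2 hi)

theorem threshold_le_of_forall_le {p : ℝ} (hx : ∀ v, 1 ≤ x v) (hw : ∀ v, w v ≤ p)
    (v : List ℕ) : threshold x w v ≤ p := by
  refine iSup_le fun n => ?_
  induction n generalizing v with
  | zero => exact bot_le
  | succ n ih =>
    rw [thresholdAux]
    exact (Finset.inf_le (Finset.mem_range.2 (hx v))).trans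
      (max_le (EReal.coe_le_coe_iff.2 (hw _)) (ih _))

theorem thresholdAux_congr {x' : List ℕ → ℕ} {v : List ℕ} (n : ℕ)
    (hx : ∀ y, v <:+ y → x y = x' y) (hw : ∀ y, v <:+ y → y ≠ v → w y = w' y) :
    thresholdAux x w n v = thresholdAux x' w' n v := by
  induction n generalizing v with
  | zero => rfl
  | succ n ih =>
    rw [thresholdAux, thresholdAux, hx v List.suffix_rfl]
    refine Finset.inf_congr rfl fun i _ => ?_
    have hs : v <:+ i :: v := List.suffix_cons i v
    rw [hw _ hs (by simp), ih (fun y hy => hx y (hs.trans hy)) fun y hy _ => hw y (hs.trans hy) ?_]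
    rintro rfl
    exact not_cons_suffix_of_suffix List.suffix_rfl hy

theorem threshold_congr {x' : List ℕ → ℕ} {v : List ℕ}
    (hx : ∀ y, v <:+ y → x y = x' y) (hw : ∀ y, v <:+ y → y ≠ v → w y = w' y) :
    threshold x w v = threshold x' w' v :=
  iSup_congr fun n => thresholdAux_congr n hx hw

theorem branchThreshold_congr {x' : List ℕ → ℕ} {v : List ℕ} (hx : ∀ y, v <:+ y → x y = x' y)
    (hw : ∀ y, v <:+ y → w y = w' y) : branchThreshold x w v = branchThreshold x' w' v := by
  rw [branchThreshold, branchThreshold, hw v List.suffix_rfl,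
    threshold_congr hx fun y hy _ => hw y hy]

theorem exists_openPath_of_thresholdAux_le {p : EReal} (hp : p < ⊤) {v : List ℕ} {n : ℕ}
    (h : thresholdAux x w n v ≤ p) :
    ∃ y, OpenPath x w (Set.Iic p) v y ∧ y.length = v.length + n := by
  induction n generalizing v with
  | zero => exact ⟨v, .refl, rfl⟩
  | succ n ih =>
    rw [thresholdAux, Finset.inf_le_iff hp] at h
    obtain ⟨i, hi, hle⟩ := h
    obtain ⟨y, hy, hlen⟩ := ih ((le_max_right _ _).trans hle)
    exact ⟨y, .head ⟨i, Finset.mem_range.1 hi, rfl, (le_max_left _ _).trans hle⟩ hy,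
      by rw [hlen, List.length_cons]; lia⟩

/-- There are arbitrarily long descending paths of weights at most `p` from `u`. -/
theorem exists_exit_of_threshold_le {p : EReal} (hp : p < ⊤) {u : List ℕ}
    (h : threshold x w u ≤ p) {S : Set (List ℕ)} (hS : S.Finite) (hu : u ∈ S) :
    ∃ i z, z ∈ S ∧ i < x z ∧ i :: z ∉ S ∧ (w (i :: z) : EReal) ≤ p := by
  obtain ⟨L, hL⟩ := (hS.image List.length).bddAbove
  obtain ⟨y, hy, hlen⟩ :=
    exists_openPath_of_thresholdAux_le hp ((thresholdAux_le_threshold (L + 1) u).trans h)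
  have hyS : y ∉ S := fun hyS => by
    have := hL ⟨y, hyS, rfl⟩
    lia
  exact hy.exists_exit hu hyS

theorem finite_openPath {p : EReal} {v : List ℕ} (hp : p < threshold x w v) :
    {y | OpenPath x w (Set.Iic p) v y}.Finite := by
  obtain ⟨n, hn⟩ := lt_iSup_iff.1 hp
  clear hp
  induction n generalizing v with
  | zero => exact absurd hn not_lt_bot
  | succ n ih =>
    rw [thresholdAux, Finset.lt_inf_iff (hn.trans_le le_top)] at hn
    have hchild : ∀ i ∈ Set.Iio (x v),
        {y | (w (i :: v) : EReal) ≤ p ∧ OpenPath x w (Set.Iic p) (i :: v) y}.Finite := by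
      intro i hi
      rcases lt_max_iff.1 (hn i (Finset.mem_range.2 hi)) with h | h
      · simp [h.not_ge]
      · exact (ih h).subset fun y hy => hy.2
    refine ((Set.finite_singleton v).union ((Set.finite_Iio (x v)).biUnion hchild)).subset ?_
    intro y hy
    rcases Relation.ReflTransGen.cases_head_iff.1 hy with rfl | ⟨_, ⟨i, hi, rfl, hle⟩, hy⟩
    · exact Or.inl rfl
    · exact Or.inr (Set.mem_biUnion (Set.mem_Iio.2 hi) ⟨hle, hy⟩)

theorem thresholdAux_le_of_ray {p : EReal} {b : ℕ → List ℕ}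
    (hb : ∀ k, ∃ i < x (b k), b (k + 1) = i :: b k) {k : ℕ}
    (hp : ∀ l, k < l → (w (b l) : EReal) ≤ p) (n : ℕ) : thresholdAux x w n (b k) ≤ p := by
  induction n generalizing k with
  | zero => exact bot_le
  | succ n ih =>
    obtain ⟨i, hi, h⟩ := hb k
    rw [thresholdAux]
    refine (Finset.inf_le (Finset.mem_range.2 hi)).trans ?_
    rw [← h]
    exact max_le (hp _ (Nat.lt_succ_self k)) (ih fun l hl => hp l (by lia))

/-! ### Invasion -/

theorem mem_boundary_of_lt {S : Set (List ℕ)} (hS : S ⊆ treeVertices x) {i : ℕ} {z : List ℕ}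
    (hz : z ∈ S) (hi : i < x z) (hiz : i :: z ∉ S) : i :: z ∈ boundary x S :=
  ⟨cons_mem_treeVertices.2 ⟨hS hz, hi⟩, hiz, i, z, hz, rfl⟩

theorem finite_boundary {S : Set (List ℕ)} (hS : S.Finite) : (boundary x S).Finite := by
  refine (hS.biUnion fun u _ => (Set.finite_Iio (x u)).image fun i => i :: u).subset ?_
  rintro v ⟨hv, -, i, u, hu, rfl⟩
  exact Set.mem_biUnion hu ⟨i, (cons_mem_treeVertices.1 hv).2, rfl⟩

theorem finite_invaded (n : ℕ) : (invaded x w n).Finite := by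
  induction n with
  | zero => exact Set.finite_singleton _
  | succ n ih => exact ih.union ((finite_boundary ih).subset fun v hv => hv.1)

theorem invaded_mono : Monotone (invaded x w) :=
  monotone_nat_of_le_succ fun _ => Set.subset_union_left

theorem invaded_subset_treeVertices (n : ℕ) : invaded x w n ⊆ treeVertices x := by
  induction n with
  | zero => rintro v rfl; exact nil_mem_treeVertices
  | succ n ih => exact Set.union_subset ih fun v hv => hv.1.1

theorem cluster_subset_treeVertices : cluster x w ⊆ treeVertices x :=
  Set.iUnion_subset invaded_subset_treeVertices

theorem lt_of_cons_mem_cluster {i : ℕ} {v : List ℕ} (h : i :: v ∈ cluster x w) : i < x v :=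
  (cons_mem_treeVertices.1 (cluster_subset_treeVertices h)).2

theorem invaded_subset_cluster (n : ℕ) : invaded x w n ⊆ cluster x w :=
  Set.subset_iUnion (invaded x w) n

theorem nil_mem_invaded (n : ℕ) : [] ∈ invaded x w n :=
  invaded_mono (Nat.zero_le n) rfl

theorem parent_mem_invaded {n i : ℕ} {v : List ℕ} (h : i :: v ∈ invaded x w (n + 1)) :
    v ∈ invaded x w n := by
  induction n with
  | zero =>
    rcases h with h | ⟨⟨-, -, j, u, hu, he⟩, -⟩
    · simp [invaded] at h
    · exact (List.cons.inj he).2 ▸ hu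
  | succ n ih =>
    rcases h with h | ⟨⟨-, -, j, u, hu, he⟩, -⟩
    · exact invaded_mono (Nat.le_succ n) (ih h)
    · exact (List.cons.inj he).2 ▸ hu

theorem mem_invaded_of_suffix {n : ℕ} {u v : List ℕ} (h : u <:+ v) (hv : v ∈ invaded x w n) :
    u ∈ invaded x w n := by
  induction v with
  | nil => rwa [List.suffix_nil.1 h]
  | cons i v ih =>
    rcases List.suffix_cons_iff.1 h with rfl | h
    · exact hv
    · exact ih h (parent_mem_invaded (invaded_mono (Nat.le_succ n) hv))

theorem mem_cluster_of_suffix {u v : List ℕ} (h : u <:+ v) (hv : v ∈ cluster x w) :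
    u ∈ cluster x w := by
  obtain ⟨n, hn⟩ := Set.mem_iUnion.1 hv
  exact invaded_subset_cluster n (mem_invaded_of_suffix h hn)

theorem parent_mem_cluster {i : ℕ} {v : List ℕ} (h : i :: v ∈ cluster x w) : v ∈ cluster x w :=
  mem_cluster_of_suffix (List.suffix_cons i v) h

theorem weight_le_of_mem_boundary {m : ℕ} {u v : List ℕ} (hu : u ∈ boundary x (invaded x w m))
    (hv : v ∈ invaded x w (m + 1)) (hv' : v ∉ invaded x w m) : w v ≤ w u :=
  (hv.resolve_left hv').2 u hu

theorem exists_invasion_step {v : List ℕ} {n : ℕ} (hv : v ∈ cluster x w)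
    (hvn : v ∉ invaded x w n) : ∃ m, n ≤ m ∧ v ∈ invaded x w (m + 1) ∧ v ∉ invaded x w m := by
  obtain ⟨l, hl⟩ := Set.mem_iUnion.1 hv
  have hnl : n ≤ l := le_of_not_ge fun hln => hvn (invaded_mono hln hl)
  induction l, hnl using Nat.le_induction with
  | base => exact absurd hl hvn
  | succ m hnm ih =>
    by_cases hm : v ∈ invaded x w m
    · exact ih hm
    · exact ⟨m, hnm, hl, hm⟩

theorem exists_invaded_before_descendants {u : List ℕ} (hu : u ∈ cluster x w) :
    ∃ n, u ∈ invaded x w n ∧ ∀ v, u <:+ v → v ≠ u → v ∉ invaded x w n := by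
  classical
  have hex : ∃ m, u ∈ invaded x w m := Set.mem_iUnion.1 hu
  refine ⟨Nat.find hex, Nat.find_spec hex, fun v huv hne hv => ?_⟩
  rcases v with _ | ⟨i, v⟩
  · exact hne (List.suffix_nil.1 huv).symm
  cases hn : Nat.find hex with
  | zero =>
    rw [hn] at hv
    simp [invaded] at hv
  | succ n =>
    rw [hn] at hv
    exact Nat.find_min hex (by lia)
      (mem_invaded_of_suffix (suffix_of_suffix_cons_of_ne huv hne) (parent_mem_invaded hv))

/-- When `v` is invaded, the boundary contains an edge of an infinite path below `u` whose weights
are at most the threshold of `u`. -/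
theorem weight_le_threshold {u v : List ℕ} (htop : threshold x w u < ⊤)
    (hv : v ∈ cluster x w) (huv : u <:+ v) (hne : v ≠ u) : (w v : EReal) ≤ threshold x w u := by
  obtain ⟨n, hun, hdesc⟩ := exists_invaded_before_descendants (mem_cluster_of_suffix huv hv)
  obtain ⟨m, hnm, hvm, hvm'⟩ := exists_invasion_step hv (hdesc v huv hne)
  obtain ⟨i, z, hz, hi, hiz, hle⟩ :=
    exists_exit_of_threshold_le htop le_rfl (finite_invaded m) (invaded_mono hnm hun)
  exact (EReal.coe_le_coe_iff.2 (weight_le_of_mem_boundary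
    (mem_boundary_of_lt (invaded_subset_treeVertices m) hz hi hiz) hvm hvm')).trans hle

/-- All vertices that `u` reaches through edges lighter than that of `v` are invaded before `v`. -/
theorem mem_cluster_of_openPath {u v y : List ℕ} (hv : v ∈ cluster x w) (huv : u <:+ v)
    (hne : v ≠ u) (hy : OpenPath x w (Set.Iio (w v : EReal)) u y) : y ∈ cluster x w := by
  obtain ⟨n, hun, hdesc⟩ := exists_invaded_before_descendants (mem_cluster_of_suffix huv hv)
  obtain ⟨m, hnm, hvm, hvm'⟩ := exists_invasion_step hv (hdesc v huv hne)
  by_contra hyT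
  obtain ⟨i, z, hz, hi, hiz, hlt⟩ := hy.exists_exit (invaded_mono hnm hun)
    (fun h => hyT (invaded_subset_cluster m h))
  exact (weight_le_of_mem_boundary (mem_boundary_of_lt (invaded_subset_treeVertices m) hz hi hiz)
    hvm hvm').not_gt (EReal.coe_lt_coe_iff.1 hlt)

theorem infinite_cluster (htop : threshold x w [] < ⊤) : (cluster x w).Infinite := by
  intro hfin
  have hmem : ∀ v ∈ cluster x w, ∃ n, v ∈ invaded x w n := fun v hv => Set.mem_iUnion.1 hv
  choose! N hN using hmem
  set m := hfin.toFinset.sup N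
  have hsub : cluster x w ⊆ invaded x w m := fun v hv =>
    invaded_mono (Finset.le_sup (f := N) (hfin.mem_toFinset.2 hv)) (hN v hv)
  obtain ⟨i, z, hz, hi, hiz, -⟩ :=
    exists_exit_of_threshold_le htop le_rfl (finite_invaded m) (nil_mem_invaded m)
  obtain ⟨v, hv, hmin⟩ := (finite_boundary (finite_invaded m)).exists_minimalFor w _
    ⟨_, mem_boundary_of_lt (invaded_subset_treeVertices m) hz hi hiz⟩
  have hv' : v ∈ invaded x w (m + 1) :=
    Or.inr ⟨hv, fun u hu => (le_total (w v) (w u)).elim id (hmin hu)⟩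
  exact hv.2.1 (hsub (invaded_subset_cluster _ hv'))

/-! ### The backbone -/

/-- `j` is the child of `v` whose branch has the strictly smallest threshold. -/
def IsMinChild (x : List ℕ → ℕ) (w : List ℕ → ℝ) (v : List ℕ) (j : ℕ) : Prop :=
  j < x v ∧ ∀ i < x v, i ≠ j → branchThreshold x w (j :: v) < branchThreshold x w (i :: v)

/-- The path from the root to `v` always moves to the child of minimal branch threshold. -/
def IsSelected (x : List ℕ → ℕ) (w : List ℕ → ℝ) (v : List ℕ) : Prop :=
  ∀ i z, i :: z <:+ v → IsMinChild x w z i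

theorem IsMinChild.unique {v : List ℕ} {i j : ℕ} (hi : IsMinChild x w v i)
    (hj : IsMinChild x w v j) : i = j := by
  by_contra h
  exact lt_asymm (hi.2 j hj.1 (Ne.symm h)) (hj.2 i hi.1 h)

theorem IsMinChild.threshold_eq {v : List ℕ} {j : ℕ} (hj : IsMinChild x w v j) :
    threshold x w v = branchThreshold x w (j :: v) := by
  refine le_antisymm (threshold_le_branchThreshold hj.1) ?_
  rw [threshold_eq_inf]
  refine Finset.le_inf fun i hi => ?_
  rcases eq_or_ne i j with rfl | h
  · exact le_rfl
  · exact (hj.2 i (Finset.mem_range.1 hi) h).le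

theorem isSelected_nil : IsSelected x w [] := fun i z h => by simp at h

theorem isSelected_cons {i : ℕ} {v : List ℕ} :
    IsSelected x w (i :: v) ↔ IsSelected x w v ∧ IsMinChild x w v i :=
  forall_cons_suffix_cons_iff

theorem IsSelected.unique {u v : List ℕ} (hu : IsSelected x w u) (hv : IsSelected x w v)
    (h : u.length = v.length) : u = v := by
  induction u generalizing v with
  | nil => exact (List.length_eq_zero_iff.1 h.symm).symm
  | cons i u ih =>
    obtain ⟨j, v, rfl⟩ := List.exists_cons_of_length_eq_add_one h.symm
    rw [isSelected_cons] at hu hv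
    obtain rfl := ih hu.1 hv.1 (by simpa using h)
    rw [hu.2.unique hv.2]

theorem openPath_of_mem_cluster {u v y : List ℕ} (htop : threshold x w u < ⊤)
    (hy : y ∈ cluster x w) (huv : u <:+ v) (hvy : v <:+ y) :
    OpenPath x w (Set.Iic (threshold x w u)) v y := by
  induction y with
  | nil => exact List.suffix_nil.1 hvy ▸ .refl
  | cons i y ih =>
    rcases List.suffix_cons_iff.1 hvy with rfl | hvy
    · exact .refl
    · refine .tail (ih (parent_mem_cluster hy) hvy) ⟨i, lt_of_cons_mem_cluster hy, rfl, ?_⟩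
      have huy := huv.trans hvy
      refine weight_le_threshold htop hy (huy.trans (List.suffix_cons i y)) ?_
      rintro rfl
      exact not_cons_suffix_of_suffix List.suffix_rfl huy

theorem IsMinChild.finite_cluster_of_ne {v : List ℕ} {i j : ℕ} (hj : IsMinChild x w v j)
    (htop : threshold x w v < ⊤) (hij : i ≠ j) : {y | y ∈ cluster x w ∧ i :: v <:+ y}.Finite := by
  rcases Set.eq_empty_or_nonempty {y | y ∈ cluster x w ∧ i :: v <:+ y} with he | ⟨y, hy, hiy⟩
  · exact he ▸ Set.finite_empty
  have hiv : i :: v ∈ cluster x w := mem_cluster_of_suffix hiy hy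
  have hlt := hj.2 i (lt_of_cons_mem_cluster hiv) hij
  rw [← hj.threshold_eq, branchThreshold, lt_max_iff] at hlt
  have hthr := hlt.resolve_left
    (weight_le_threshold htop hiv (List.suffix_cons i v) (by simp)).not_gt
  exact (finite_openPath hthr).subset fun y hy =>
    openPath_of_mem_cluster htop hy.1 (List.suffix_cons i v) hy.2

theorem IsMinChild.finite_cluster_off {v : List ℕ} {j : ℕ} (hj : IsMinChild x w v j)
    (htop : threshold x w v < ⊤) : {y | y ∈ cluster x w ∧ v <:+ y ∧ ¬ j :: v <:+ y}.Finite := by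
  have hfin : (⋃ i ∈ Set.Iio (x v) \ {j}, {y | y ∈ cluster x w ∧ i :: v <:+ y}).Finite :=
    (Set.finite_Iio (x v)).sdiff.biUnion fun i hi => hj.finite_cluster_of_ne htop hi.2
  refine ((Set.finite_singleton v).union hfin).subset ?_
  rintro y ⟨hy, hvy, hjy⟩
  by_cases hne : y = v
  · exact Or.inl hne
  · obtain ⟨i, hi⟩ := exists_cons_suffix hvy hne
    refine Or.inr (Set.mem_biUnion (x := i) ⟨?_, ?_⟩ ⟨hy, hi⟩)
    · exact lt_of_cons_mem_cluster (mem_cluster_of_suffix hi hy)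
    · rintro rfl
      exact hjy hi

theorem IsMinChild.infinite_cluster {v : List ℕ} {j : ℕ} (hj : IsMinChild x w v j)
    (htop : threshold x w v < ⊤) (hv : {y | y ∈ cluster x w ∧ v <:+ y}.Infinite) :
    {y | y ∈ cluster x w ∧ j :: v <:+ y}.Infinite := fun hfin =>
  hv ((hfin.union (hj.finite_cluster_off htop)).subset fun y hy =>
    (em (j :: v <:+ y)).imp (fun h => ⟨hy.1, h⟩) fun h => ⟨hy.1, hy.2, h⟩)

namespace IsBackbone

variable {b : ℕ → List ℕ}

theorem length_eq (hb : IsBackbone x w b) (k : ℕ) : (b k).length = k := by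
  induction k with
  | zero => rw [hb.1, List.length_nil]
  | succ k ih =>
    obtain ⟨i, hi⟩ := hb.2.1 k
    rw [hi, List.length_cons, ih]

theorem injective (hb : IsBackbone x w b) : Function.Injective b :=
  Function.LeftInverse.injective hb.length_eq

theorem suffix (hb : IsBackbone x w b) {k l : ℕ} (hkl : k ≤ l) : b k <:+ b l := by
  induction hkl with
  | refl => exact List.suffix_rfl
  | step _ ih =>
    obtain ⟨i, hi⟩ := hb.2.1 _
    exact hi ▸ ih.trans (List.suffix_cons i _)

theorem not_succ_suffix (hb : IsBackbone x w b) (k : ℕ) : ¬ b (k + 1) <:+ b k := by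
  obtain ⟨i, hi⟩ := hb.2.1 k
  exact hi ▸ not_cons_suffix_of_suffix List.suffix_rfl

theorem infinite (hb : IsBackbone x w b) (k : ℕ) : {y | y ∈ cluster x w ∧ b k <:+ y}.Infinite :=
  Set.infinite_of_injective_forall_mem (hb.injective.comp (add_right_injective k)) fun n =>
    ⟨hb.2.2 (k + n), hb.suffix (Nat.le_add_right k n)⟩

theorem weight_le_threshold (hb : IsBackbone x w b) {k l : ℕ} (hkl : k < l)
    (htop : threshold x w (b k) < ⊤) : (w (b l) : EReal) ≤ threshold x w (b k) :=
  InvasionPercolation.weight_le_threshold htop (hb.2.2 l) (hb.suffix hkl.le)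
    (hb.injective.ne hkl.ne')

end IsBackbone

/-- The properties of a realisation of the weighted tree that hold almost surely and that determine
the shape of the invasion percolation cluster. -/
structure IsRegular (x : List ℕ → ℕ) (w : List ℕ → ℝ) : Prop where
  one_le_offspring : ∀ v, 1 ≤ x v
  pos : ∀ v, 0 < w v
  le_one : ∀ v, w v ≤ 1
  injective : Function.Injective w
  branchThreshold_ne : ∀ v i j, i < x v → j < x v → i ≠ j →
    branchThreshold x w (i :: v) ≠ branchThreshold x w (j :: v)
  threshold_ne : ∀ y z, ¬ z <:+ y → threshold x w z ≠ w y

namespace IsRegular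

variable (h : IsRegular x w)
include h

theorem threshold_lt_top (v : List ℕ) : threshold x w v < ⊤ :=
  (threshold_le_of_forall_le h.one_le_offspring h.le_one v).trans_lt (EReal.coe_lt_top 1)

theorem branchThreshold_lt_top (v : List ℕ) : branchThreshold x w v < ⊤ :=
  max_lt (EReal.coe_lt_top _) (h.threshold_lt_top v)

theorem weight_ne_branchThreshold {v y : List ℕ} (hvy : ¬ v <:+ y) :
    (w y : EReal) ≠ branchThreshold x w v := by
  rcases max_choice (w v : EReal) (threshold x w v) with hmax | hmax <;> rw [branchThreshold, hmax]
  · exact fun he => hvy (h.injective (EReal.coe_eq_coe_iff.1 he) ▸ List.suffix_rfl)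
  · exact (h.threshold_ne y v hvy).symm

theorem exists_isMinChild (v : List ℕ) : ∃ j, IsMinChild x w v j := by
  obtain ⟨j, hj, hmin⟩ := Finset.exists_min_image (Finset.range (x v))
    (fun i => branchThreshold x w (i :: v)) ⟨0, Finset.mem_range.2 (h.one_le_offspring v)⟩
  exact ⟨j, Finset.mem_range.1 hj, fun i hi hij => (hmin i (Finset.mem_range.2 hi)).lt_of_ne
    (h.branchThreshold_ne v j i (Finset.mem_range.1 hj) hi hij.symm)⟩

theorem exists_isBackbone : ∃ b, IsBackbone x w b := by
  choose f hf using h.exists_isMinChild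
  let b : ℕ → List ℕ := fun k => Nat.rec [] (fun _ v => f v :: v) k
  have hinf : ∀ k, {y | y ∈ cluster x w ∧ b k <:+ y}.Infinite := by
    intro k
    induction k with
    | zero => simpa [b] using infinite_cluster (h.threshold_lt_top [])
    | succ k ih => exact (hf _).infinite_cluster (h.threshold_lt_top _) ih
  refine ⟨b, rfl, fun k => ⟨f (b k), rfl⟩, fun k => ?_⟩
  obtain ⟨y, hy, hs⟩ := (hinf k).nonempty
  exact mem_cluster_of_suffix hs hy

theorem exists_isMinChild_of_isBackbone {b : ℕ → List ℕ} (hb : IsBackbone x w b) (k : ℕ) :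
    ∃ i, b (k + 1) = i :: b k ∧ IsMinChild x w (b k) i := by
  obtain ⟨i, hi⟩ := hb.2.1 k
  obtain ⟨j, hj⟩ := h.exists_isMinChild (b k)
  have hij : i = j := by
    by_contra hij
    exact hb.infinite (k + 1) (hi ▸ hj.finite_cluster_of_ne (h.threshold_lt_top _) hij)
  exact ⟨i, hi, hij ▸ hj⟩

theorem isSelected_of_isBackbone {b : ℕ → List ℕ} (hb : IsBackbone x w b) (k : ℕ) :
    IsSelected x w (b k) := by
  induction k with
  | zero => exact hb.1 ▸ isSelected_nil
  | succ k ih =>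
    obtain ⟨i, hi, hm⟩ := h.exists_isMinChild_of_isBackbone hb k
    exact hi ▸ isSelected_cons.2 ⟨ih, hm⟩

theorem existsUnique_isBackbone : ∃! b, IsBackbone x w b := by
  obtain ⟨b, hb⟩ := h.exists_isBackbone
  exact ⟨b, hb, fun b' hb' => funext fun k => (h.isSelected_of_isBackbone hb' k).unique
    (h.isSelected_of_isBackbone hb k) (by rw [hb.length_eq, hb'.length_eq])⟩

theorem isBackbone_backbone : IsBackbone x w (backbone x w) :=
  Classical.epsilon_spec h.exists_isBackbone

theorem exists_isMinChild_backbone (k : ℕ) : ∃ i,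
    backbone x w (k + 1) = i :: backbone x w k ∧ IsMinChild x w (backbone x w k) i :=
  h.exists_isMinChild_of_isBackbone h.isBackbone_backbone k

theorem backbone_eq {u : List ℕ} (hu : IsSelected x w u) : backbone x w u.length = u :=
  (h.isSelected_of_isBackbone h.isBackbone_backbone _).unique hu
    (h.isBackbone_backbone.length_eq _)

theorem threshold_backbone (k : ℕ) :
    threshold x w (backbone x w k) = branchThreshold x w (backbone x w (k + 1)) := by
  obtain ⟨i, hi, hm⟩ := h.exists_isMinChild_backbone k
  rw [hi, hm.threshold_eq]

theorem threshold_backbone_le {k : ℕ} {p : EReal}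
    (hp : ∀ l, k < l → (w (backbone x w l) : EReal) ≤ p) : threshold x w (backbone x w k) ≤ p := by
  refine iSup_le (thresholdAux_le_of_ray (fun k => ?_) hp)
  obtain ⟨i, hi, hm⟩ := h.exists_isMinChild_backbone k
  exact ⟨i, hm.1, hi⟩

theorem coe_futureMax (k : ℕ) : (futureMax x w k : EReal) = threshold x w (backbone x w k) := by
  have hle : ∀ l, k < l → (w (backbone x w l) : EReal) ≤ threshold x w (backbone x w k) :=
    fun l hl => h.isBackbone_backbone.weight_le_threshold hl (h.threshold_lt_top _)
  have hbot : ⊥ < threshold x w (backbone x w k) :=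
    (EReal.bot_lt_coe _).trans_le (hle (k + 1) (Nat.lt_succ_self k))
  apply le_antisymm
  · rw [← EReal.coe_toReal (h.threshold_lt_top _).ne hbot.ne'] at hle ⊢
    refine EReal.coe_le_coe_iff.2 (csSup_le ⟨_, k + 1, Nat.lt_succ_self k, rfl⟩ ?_)
    rintro _ ⟨i, hi, rfl⟩
    exact EReal.coe_le_coe_iff.1 (hle i hi)
  · have hbdd : BddAbove {β | ∃ i, k < i ∧ β = w (backbone x w i)} :=
      ⟨1, by rintro _ ⟨i, -, rfl⟩; exact h.le_one _⟩
    exact h.threshold_backbone_le fun l hl => EReal.coe_le_coe_iff.2 (le_csSup hbdd ⟨l, hl, rfl⟩)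

theorem mem_cluster_of_openPath_backbone {k : ℕ} {y : List ℕ}
    (hy : OpenPath x w (Set.Iio (threshold x w (backbone x w k))) (backbone x w k) y) :
    y ∈ cluster x w := by
  have hb := h.isBackbone_backbone
  obtain ⟨p, hp, hpath⟩ := hy.exists_lt (h.coe_futureMax k ▸ EReal.bot_lt_coe _)
  obtain ⟨l, hl, hpl⟩ : ∃ l, k < l ∧ p < w (backbone x w l) := by
    by_contra! hle
    exact (h.threshold_backbone_le hle).not_gt hp
  exact mem_cluster_of_openPath (hb.2.2 l) (hb.suffix hl.le) (hb.injective.ne hl.ne')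
    (hpath.mono fun _ hq => lt_of_le_of_lt hq hpl)

/-! ### The forests off the backbone -/

theorem mem_forest {k : ℕ} {y : List ℕ} : y ∈ forest x w k ↔
    y ∈ cluster x w ∧ backbone x w k <:+ y ∧ y ≠ backbone x w k ∧ ¬ backbone x w (k + 1) <:+ y := by
  cases k with
  | zero =>
    simp only [forest, cut, Set.mem_sdiff, Set.mem_ofPred_eq, Set.mem_singleton_iff,
      h.isBackbone_backbone.1, List.nil_suffix, true_and]
    tauto
  | succ k =>
    simp only [forest, cut, Set.mem_sdiff, Set.mem_ofPred_eq, Set.mem_singleton_iff]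
    tauto

theorem finite_cluster_between (k : ℕ) : {y | y ∈ cluster x w ∧
    backbone x w k <:+ y ∧ ¬ backbone x w (k + 1) <:+ y}.Finite := by
  obtain ⟨j, hj, hm⟩ := h.exists_isMinChild_backbone k
  exact hj ▸ hm.finite_cluster_off (h.threshold_lt_top _)

theorem finite_cut (k : ℕ) : (cut x w k).Finite := by
  induction k with
  | zero =>
    refine (h.finite_cluster_between 0).subset fun y hy => ⟨hy.1, ?_, hy.2⟩
    rw [h.isBackbone_backbone.1]
    exact List.nil_suffix
  | succ k ih =>
    refine (ih.union (h.finite_cluster_between (k + 1))).subset fun y hy => ?_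
    by_cases hky : backbone x w (k + 1) <:+ y
    · exact Or.inr ⟨hy.1, hky, hy.2⟩
    · exact Or.inl ⟨hy.1, hky⟩

theorem cut_subset_cut_succ (k : ℕ) : cut x w k ⊆ cut x w (k + 1) := fun _ hy =>
  ⟨hy.1, fun hs => hy.2 ((h.isBackbone_backbone.suffix (Nat.le_succ _)).trans hs)⟩

theorem finite_forest (k : ℕ) : (forest x w k).Finite :=
  (h.finite_cluster_between k).subset fun _ hy =>
    let ⟨hT, hk, _, hk'⟩ := h.mem_forest.1 hy
    ⟨hT, hk, hk'⟩

theorem backbone_mem_cut_sdiff (k : ℕ) :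
    backbone x w (k + 1) ∈ cut x w (k + 1) \ cut x w k :=
  ⟨⟨h.isBackbone_backbone.2.2 _, h.isBackbone_backbone.not_succ_suffix _⟩,
    fun hk => hk.2 List.suffix_rfl⟩

theorem nil_mem_cut (k : ℕ) : [] ∈ cut x w k := by
  refine ⟨invaded_subset_cluster 0 (nil_mem_invaded 0), fun hs => ?_⟩
  have := hs.length_le
  rw [h.isBackbone_backbone.length_eq] at this
  simp at this

theorem attachedWeight_eq (k : ℕ) : attachedWeight x w k = ∑ᶠ v ∈ forest x w k, w v := by
  cases k with
  | zero => rw [attachedWeight, cutWeight, forest, h.isBackbone_backbone.1]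
  | succ k =>
    have hsdiff : (cut x w (k + 1) \ {[]}) \ (cut x w k \ {[]}) =
        insert (backbone x w (k + 1)) (forest x w (k + 1)) := by
      rw [forest, Set.insert_sdiff_singleton, Set.insert_eq_of_mem (h.backbone_mem_cut_sdiff k)]
      ext y
      have hnil : y = [] → y ∈ cut x w k := fun he => he ▸ h.nil_mem_cut k
      simp only [Set.mem_sdiff, Set.mem_singleton_iff]
      tauto
    rw [attachedWeight, cutWeight, cutWeight, ← finsum_mem_add_sdiff
      (Set.sdiff_subset_sdiff_left (h.cut_subset_cut_succ k)) (h.finite_cut (k + 1)).sdiff, hsdiff,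
      finsum_mem_insert _ (by simp [forest]) (h.finite_forest _)]
    ring

theorem parent_mem_forest {k i : ℕ} {z : List ℕ} (hi : i :: z ∈ forest x w k) :
    z = backbone x w k ∨ z ∈ forest x w k := by
  obtain ⟨hT, hk, hne, hk'⟩ := h.mem_forest.1 hi
  exact or_iff_not_imp_left.2 fun hz => h.mem_forest.2 ⟨parent_mem_cluster hT,
    suffix_of_suffix_cons_of_ne hk hne, hz, fun hs => hk' (hs.trans (List.suffix_cons i z))⟩

theorem weight_lt_of_mem_forest {k : ℕ} {y : List ℕ} (hy : y ∈ forest x w k) :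
    (w y : EReal) < threshold x w (backbone x w k) := by
  obtain ⟨hT, hk, hne, hk'⟩ := h.mem_forest.1 hy
  refine (weight_le_threshold (h.threshold_lt_top _) hT hk hne).lt_of_ne ?_
  rw [h.threshold_backbone]
  exact h.weight_ne_branchThreshold hk'

theorem openPath_of_mem_forest {k : ℕ} {y : List ℕ} (hy : y ∈ forest x w k) :
    OpenPath x w (Set.Iio (threshold x w (backbone x w k))) (backbone x w k) y := by
  induction y with
  | nil => exact absurd (List.suffix_nil.1 (h.mem_forest.1 hy).2.1).symm (h.mem_forest.1 hy).2.2.1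
  | cons i z ih =>
    have hedge : OpenEdge x w (Set.Iio (threshold x w (backbone x w k))) z (i :: z) :=
      ⟨i, lt_of_cons_mem_cluster (h.mem_forest.1 hy).1, rfl, h.weight_lt_of_mem_forest hy⟩
    rcases h.parent_mem_forest hy with rfl | hz
    · exact .single hedge
    · exact .tail (ih hz) hedge

theorem cons_mem_forest {k i : ℕ} {z : List ℕ} (hz : z = backbone x w k ∨ z ∈ forest x w k)
    (hi : i < x z) (hne : i :: z ≠ backbone x w (k + 1))
    (hlt : (w (i :: z) : EReal) < threshold x w (backbone x w k)) : i :: z ∈ forest x w k := by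
  have hpath : OpenPath x w (Set.Iio (threshold x w (backbone x w k))) (backbone x w k) z :=
    hz.elim (fun he => he ▸ .refl) h.openPath_of_mem_forest
  refine h.mem_forest.2 ⟨h.mem_cluster_of_openPath_backbone (hpath.tail ⟨i, hi, rfl, hlt⟩),
    hpath.suffix.trans (List.suffix_cons i z), fun he => ?_, fun hs => ?_⟩
  · exact not_cons_suffix_of_suffix List.suffix_rfl (he ▸ hpath.suffix)
  · have hz' := suffix_of_suffix_cons_of_ne hs hne
    rcases hz with rfl | hz
    · exact h.isBackbone_backbone.not_succ_suffix k hz'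
    · exact (h.mem_forest.1 hz).2.2.2 hz'

end IsRegular

end

section

variable {x : List ℕ → ℕ} {w w' : List ℕ → ℝ} {u : List ℕ} {j : ℕ} {F : Finset (List ℕ)}

/-! ### A local description of the forests -/

/-- `F` is a set of proper descendants of `u`, not below `j :: u`, that consists of the vertices
which are joined to `u` by edges of weight less than the threshold of the branch of `j :: u`, and
the remaining edges at `F` and at `u` exceed this threshold. -/
structure IsOffspringForest (x : List ℕ → ℕ) (w : List ℕ → ℝ) (u : List ℕ) (j : ℕ)
    (F : Finset (List ℕ)) : Prop where
  child_lt : j < x u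
  nil_notMem : [] ∉ F
  child_notMem : j :: u ∉ F
  parent : ∀ i z, i :: z ∈ F → (z = u ∨ z ∈ F) ∧ i < x z
  inner : ∀ y ∈ F, (w y : EReal) < branchThreshold x w (j :: u)
  outer : ∀ i z, (z = u ∨ z ∈ F) → i < x z → i :: z ∉ F → i :: z ≠ j :: u →
    branchThreshold x w (j :: u) < w (i :: z)

namespace IsOffspringForest

theorem openPath (h : IsOffspringForest x w u j F) {y : List ℕ} (hy : y ∈ F) :
    OpenPath x w (Set.Iio (branchThreshold x w (j :: u))) u y := by
  induction y with
  | nil => exact absurd hy h.nil_notMem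
  | cons i z ih =>
    obtain ⟨hz, hi⟩ := h.parent i z hy
    have hedge : OpenEdge x w (Set.Iio (branchThreshold x w (j :: u))) z (i :: z) :=
      ⟨i, hi, rfl, h.inner _ hy⟩
    rcases hz with rfl | hz
    · exact .single hedge
    · exact .tail (ih hz) hedge

theorem not_cons_suffix (h : IsOffspringForest x w u j F) {y : List ℕ} (hy : y ∈ F) :
    ¬ j :: u <:+ y := by
  induction y with
  | nil => simp
  | cons i z ih =>
    intro hs
    have hz := suffix_of_suffix_cons_of_ne hs fun he => h.child_notMem (he ▸ hy)
    rcases (h.parent i z hy).1 with rfl | hzF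
    · exact not_cons_suffix_of_suffix List.suffix_rfl hz
    · exact ih hzF hz

theorem notMem_of_suffix (h : IsOffspringForest x w u j F) {s : List ℕ} (hs : s <:+ u) :
    s ∉ F := by
  intro hsF
  cases s with
  | nil => exact h.nil_notMem hsF
  | cons i z =>
    rcases (h.parent i z hsF).1 with rfl | hz
    · exact not_cons_suffix_of_suffix List.suffix_rfl hs
    · exact not_cons_suffix_of_suffix (h.openPath hz).suffix hs

theorem lt_branchThreshold (h : IsOffspringForest x w u j F)
    (htop : branchThreshold x w (j :: u) < ⊤) {i : ℕ} (hi : i < x u) (hij : i ≠ j) :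
    branchThreshold x w (j :: u) < branchThreshold x w (i :: u) := by
  by_cases hiF : i :: u ∈ F
  · refine lt_max_of_lt_right ?_
    by_contra! hle
    obtain ⟨i', z, hz, hi', hzF, hle'⟩ := exists_exit_of_threshold_le htop hle F.finite_toSet hiF
    refine (h.outer i' z (Or.inr hz) hi' hzF fun he => ?_).not_ge hle'
    exact h.notMem_of_suffix List.suffix_rfl ((List.cons.inj he).2 ▸ hz)
  · exact lt_max_of_lt_left (h.outer i u (Or.inl rfl) hi hiF (by simpa using hij))

theorem isMinChild (h : IsOffspringForest x w u j F) (htop : branchThreshold x w (j :: u) < ⊤) :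
    IsMinChild x w u j :=
  ⟨h.child_lt, fun _ => h.lt_branchThreshold htop⟩

theorem branchThreshold_eq (h : IsOffspringForest x w u j F) (hw : ∀ y ∉ F, w y = w' y) :
    branchThreshold x w (j :: u) = branchThreshold x w' (j :: u) :=
  branchThreshold_congr (fun _ _ => rfl) fun y hy => hw y fun hyF => h.not_cons_suffix hyF hy

theorem resample (h : IsOffspringForest x w u j F) (hw : ∀ y ∉ F, w y = w' y)
    (hF : ∀ y ∈ F, (w' y : EReal) < branchThreshold x w (j :: u)) :
    IsOffspringForest x w' u j F where
  child_lt := h.child_lt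
  nil_notMem := h.nil_notMem
  child_notMem := h.child_notMem
  parent := h.parent
  inner := h.branchThreshold_eq hw ▸ hF
  outer i z hz hi hiz hne := by
    rw [← h.branchThreshold_eq hw, ← hw _ hiz]
    exact h.outer i z hz hi hiz hne

theorem branchThreshold_sibling_eq (h : IsOffspringForest x w u j F) (hw : ∀ y ∉ F, w y = w' y)
    {i i' : ℕ} {z : List ℕ} (hz : i :: z <:+ u) (hne : i' ≠ i) :
    branchThreshold x w (i' :: z) = branchThreshold x w' (i' :: z) := by
  refine branchThreshold_congr (fun _ _ => rfl) fun y hy => hw y fun hyF => hne ?_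
  exact eq_of_cons_suffix hy (hz.trans (h.openPath hyF).suffix)

theorem threshold_eq_of_suffix (h : IsOffspringForest x w u j F)
    (h' : IsOffspringForest x w' u j F) (htop : branchThreshold x w (j :: u) < ⊤)
    (hw : ∀ y ∉ F, w y = w' y) {s : List ℕ} (hs : s <:+ u) :
    threshold x w s = threshold x w' s := by
  obtain ⟨t, ht⟩ := hs
  induction t using List.reverseRecOn generalizing s with
  | nil =>
    obtain rfl : s = u := by simpa using ht
    rw [(h.isMinChild htop).threshold_eq, h.branchThreshold_eq hw,
      (h'.isMinChild (h.branchThreshold_eq hw ▸ htop)).threshold_eq]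
  | append_singleton t i ih =>
    have hi : t ++ i :: s = u := by simpa using ht
    rw [threshold_eq_inf, threshold_eq_inf]
    refine Finset.inf_congr rfl fun i' _ => ?_
    rcases eq_or_ne i' i with rfl | hne
    · rw [branchThreshold, branchThreshold, ih hi, hw _ (h.notMem_of_suffix ⟨t, hi⟩)]
    · exact h.branchThreshold_sibling_eq hw ⟨t, hi⟩ hne

end IsOffspringForest

/-- The vertex `u` is selected, and so is its child `j :: u`, with off-backbone forest `F`. -/
structure IsLocalForest (x : List ℕ → ℕ) (w : List ℕ → ℝ) (u : List ℕ) (j : ℕ)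
    (F : Finset (List ℕ)) : Prop where
  isSelected : IsSelected x w u
  isOffspringForest : IsOffspringForest x w u j F

/-- The local description survives a change of the weights on the forest that keeps them below the
threshold, which is the future maximum weight and does not change. -/
theorem IsLocalForest.resample (h : IsLocalForest x w u j F) (hw : ∀ y ∉ F, w y = w' y)
    (hF : ∀ y ∈ F, (w' y : EReal) < branchThreshold x w (j :: u))
    (htop : branchThreshold x w (j :: u) < ⊤) : IsLocalForest x w' u j F := by
  have hfor := h.isOffspringForest
  have hfor' := hfor.resample hw hF
  refine ⟨fun i z hz => ⟨(h.isSelected i z hz).1, fun i' hi' hne => ?_⟩, hfor'⟩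
  have hpath : branchThreshold x w (i :: z) = branchThreshold x w' (i :: z) := by
    rw [branchThreshold, branchThreshold, hfor.threshold_eq_of_suffix hfor' htop hw hz,
      hw _ (hfor.notMem_of_suffix hz)]
  rw [← hpath, ← hfor.branchThreshold_sibling_eq hw hz hne]
  exact (h.isSelected i z hz).2 i' hi' hne

namespace IsRegular

variable (h : IsRegular x w)
include h

theorem backbone_eq_of_isLocalForest (hF : IsLocalForest x w u j F) :
    backbone x w u.length = u ∧ backbone x w (u.length + 1) = j :: u :=
  ⟨h.backbone_eq hF.isSelected, h.backbone_eq (isSelected_cons.2 ⟨hF.isSelected,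
    hF.isOffspringForest.isMinChild (h.branchThreshold_lt_top _)⟩)⟩

theorem coe_futureMax_of_isLocalForest (hF : IsLocalForest x w u j F) :
    (futureMax x w u.length : EReal) = branchThreshold x w (j :: u) := by
  rw [h.coe_futureMax, h.threshold_backbone, (h.backbone_eq_of_isLocalForest hF).2]

theorem forest_eq_of_isLocalForest (hF : IsLocalForest x w u j F) :
    forest x w u.length = F := by
  obtain ⟨hb, hb'⟩ := h.backbone_eq_of_isLocalForest hF
  have hthr : threshold x w u = branchThreshold x w (j :: u) := by
    rw [← hb', ← h.threshold_backbone, hb]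
  have hfor := hF.isOffspringForest
  ext y
  constructor
  · intro hy
    induction y with
    | nil => exact absurd (List.suffix_nil.1 (h.mem_forest.1 hy).2.1).symm (h.mem_forest.1 hy).2.2.1
    | cons i z ih =>
      by_contra hyF
      have hz : z = u ∨ z ∈ F := (h.parent_mem_forest hy).imp (fun he => he.trans hb) ih
      refine (hfor.outer i z hz (lt_of_cons_mem_cluster (h.mem_forest.1 hy).1) hyF
        fun he => ?_).not_gt (by simpa only [hb, hthr] using h.weight_lt_of_mem_forest hy)
      exact (h.mem_forest.1 hy).2.2.2 (by rw [hb', he])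
  · intro hy
    have hpath := hfor.openPath hy
    rw [h.mem_forest, hb, hb']
    refine ⟨h.mem_cluster_of_openPath_backbone (k := u.length) (by rwa [hb, hthr]), hpath.suffix,
      ?_, hfor.not_cons_suffix hy⟩
    rintro rfl
    exact hfor.notMem_of_suffix List.suffix_rfl hy

theorem isOffspringForest_of_forest_eq {k : ℕ} (hj : backbone x w (k + 1) = j :: backbone x w k)
    (hm : IsMinChild x w (backbone x w k) j) (hF : forest x w k = F) :
    IsOffspringForest x w (backbone x w k) j F := by
  have hmem : ∀ y, y ∈ F ↔ y ∈ forest x w k := fun y => by rw [hF, Finset.mem_coe]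
  refine ⟨hm.1, fun h0 => ?_, fun hjF => ?_, fun i z hz => ?_, fun y hy => ?_,
    fun i z hz hi hiz hne => lt_of_not_ge fun hle => hiz ?_⟩
  · obtain ⟨-, hs, hne, -⟩ := h.mem_forest.1 ((hmem _).1 h0)
    exact hne (List.suffix_nil.1 hs).symm
  · exact (h.mem_forest.1 ((hmem _).1 hjF)).2.2.2 (hj ▸ List.suffix_rfl)
  · rw [hmem] at hz ⊢
    exact ⟨h.parent_mem_forest hz, lt_of_cons_mem_cluster (h.mem_forest.1 hz).1⟩
  · exact hm.threshold_eq ▸ h.weight_lt_of_mem_forest ((hmem y).1 hy)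
  · rw [hmem] at hz ⊢
    refine h.cons_mem_forest hz hi (hj ▸ hne)
      (hm.threshold_eq ▸ hle.lt_of_ne (h.weight_ne_branchThreshold fun hs => ?_))
    have hjz := suffix_of_suffix_cons_of_ne hs hne
    rcases hz with rfl | hz
    · exact not_cons_suffix_of_suffix List.suffix_rfl hjz
    · exact (h.mem_forest.1 hz).2.2.2 (hj ▸ hjz)

theorem forest_eq_iff {k : ℕ} :
    forest x w k = F ↔ ∃ u j, u.length = k ∧ IsLocalForest x w u j F := by
  refine ⟨fun hF => ?_, ?_⟩
  · have hb := h.isBackbone_backbone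
    obtain ⟨j, hj, hm⟩ := h.exists_isMinChild_backbone k
    exact ⟨_, j, hb.length_eq k, h.isSelected_of_isBackbone hb k,
      h.isOffspringForest_of_forest_eq hj hm hF⟩
  · rintro ⟨u, j, rfl, hF⟩
    exact h.forest_eq_of_isLocalForest hF

end IsRegular

end

/-! ### Measurability -/

section

variable {β : Type*} [MeasurableSpace β]

theorem measurable_inf_range {N : β → ℕ} {f : ℕ → β → EReal} (hN : Measurable N)
    (hf : ∀ i, Measurable (f i)) : Measurable fun b => (Finset.range (N b)).inf fun i => f i b := by
  have h : Measurable fun q : ℕ × β => (Finset.range q.1).inf fun i => f i q.2 := by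
    refine measurable_from_prod_countable_right fun n => ?_
    induction n with
    | zero => simp
    | succ n ih =>
      simp only [Finset.range_add_one, Finset.inf_insert]
      exact (hf n).min ih
  exact h.comp (hN.prodMk measurable_id)

variable {x : β → List ℕ → ℕ} {w : β → List ℕ → ℝ}

@[fun_prop]
theorem measurable_thresholdAux (hx : Measurable x) (hw : Measurable w) (n : ℕ) (v : List ℕ) :
    Measurable fun b => thresholdAux (x b) (w b) n v := by
  induction n generalizing v with
  | zero => exact measurable_const
  | succ n ih =>
    simp only [thresholdAux]
    exact measurable_inf_range (by fun_prop) fun i => Measurable.max (by fun_prop) (ih _)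

@[fun_prop]
theorem measurable_threshold (hx : Measurable x) (hw : Measurable w) (v : List ℕ) :
    Measurable fun b => threshold (x b) (w b) v :=
  Measurable.iSup fun n => measurable_thresholdAux hx hw n v

@[fun_prop]
theorem measurable_branchThreshold (hx : Measurable x) (hw : Measurable w) (v : List ℕ) :
    Measurable fun b => branchThreshold (x b) (w b) v :=
  Measurable.max (by fun_prop) (measurable_threshold hx hw v)

@[fun_prop]
theorem measurable_isMinChild (hx : Measurable x) (hw : Measurable w) (v : List ℕ) (j : ℕ) :
    Measurable fun b => IsMinChild (x b) (w b) v j :=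
  (Measurable.lt (by fun_prop) (by fun_prop)).and <| .forall fun i =>
    (Measurable.lt (by fun_prop) (by fun_prop)).imp <| measurable_const.imp <|
      Measurable.lt (by fun_prop) (by fun_prop)

@[fun_prop]
theorem measurable_isSelected (hx : Measurable x) (hw : Measurable w) (v : List ℕ) :
    Measurable fun b => IsSelected (x b) (w b) v :=
  .forall fun i => .forall fun z => measurable_const.imp (by fun_prop)

theorem isOffspringForest_iff {x : List ℕ → ℕ} {w : List ℕ → ℝ} {u : List ℕ} {j : ℕ}
    {F : Finset (List ℕ)} : IsOffspringForest x w u j F ↔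
      j < x u ∧ ([] ∉ F ∧ j :: u ∉ F) ∧ (∀ i z, i :: z ∈ F → (z = u ∨ z ∈ F) ∧ i < x z) ∧
      (∀ y ∈ F, (w y : EReal) < branchThreshold x w (j :: u)) ∧
      ∀ i z, (z = u ∨ z ∈ F) → i < x z → i :: z ∉ F → i :: z ≠ j :: u →
        branchThreshold x w (j :: u) < w (i :: z) :=
  ⟨fun h => ⟨h.1, ⟨h.2, h.3⟩, h.4, h.5, h.6⟩,
    fun ⟨h₁, ⟨h₂, h₃⟩, h₄, h₅, h₆⟩ => ⟨h₁, h₂, h₃, h₄, h₅, h₆⟩⟩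

@[fun_prop]
theorem measurable_isOffspringForest (hx : Measurable x) (hw : Measurable w) (u : List ℕ) (j : ℕ)
    (F : Finset (List ℕ)) : Measurable fun b => IsOffspringForest (x b) (w b) u j F := by
  simp only [isOffspringForest_iff]
  exact (Measurable.lt (by fun_prop) (by fun_prop)).and <| measurable_const.and <|
    .and (.forall fun i => .forall fun z => measurable_const.imp <| measurable_const.and <|
      .lt (by fun_prop) (by fun_prop)) <|
    .and (.forall fun y => measurable_const.imp <| .lt (by fun_prop) (by fun_prop)) <|
    .forall fun i => .forall fun z => measurable_const.imp <|
      (Measurable.lt (by fun_prop) (by fun_prop)).imp <| measurable_const.imp <|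
        measurable_const.imp <| .lt (by fun_prop) (by fun_prop)

@[fun_prop]
theorem measurable_isLocalForest (hx : Measurable x) (hw : Measurable w) (u : List ℕ) (j : ℕ)
    (F : Finset (List ℕ)) : Measurable fun b => IsLocalForest (x b) (w b) u j F := by
  have hiff (b : β) : IsLocalForest (x b) (w b) u j F ↔
      IsSelected (x b) (w b) u ∧ IsOffspringForest (x b) (w b) u j F :=
    ⟨fun h => ⟨h.1, h.2⟩, fun h => ⟨h.1, h.2⟩⟩
  simp only [hiff]
  fun_prop

end

/-! ### Independence of disjoint parts of the weighted tree -/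

/-- The offspring numbers and the edge weights of a realisation of the weighted tree. -/
abbrev Config : Type := (List ℕ → ℕ) × (List ℕ → ℝ)

/-- `f` depends only on the offspring numbers of the vertices in `V` and on the weights of the edges
in `E`, an edge being named by its endpoint away from the root. -/
def IsDeterminedBy {β : Type*} (V E : Set (List ℕ)) (f : Config → β) : Prop :=
  ∀ c c' : Config, Set.EqOn c.1 c'.1 V → Set.EqOn c.2 c'.2 E → f c = f c'

theorem IsDeterminedBy.measurable {Ω β : Type*} {_ : MeasurableSpace Ω} [MeasurableSpace β]
    {V E : Set (List ℕ)} {f : Config → β} (hfV : IsDeterminedBy V E f) (hf : Measurable f)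
    {x : Ω → List ℕ → ℕ} {w : Ω → List ℕ → ℝ} (hx : ∀ v ∈ V, Measurable fun ω => x ω v)
    (hw : ∀ v ∈ E, Measurable fun ω => w ω v) : Measurable fun ω => f (x ω, w ω) := by
  have hrestrict (c : Config) : f (V.indicator c.1, E.indicator c.2) = f c :=
    hfV _ _ Set.eqOn_indicator Set.eqOn_indicator
  rw [← funext fun ω => hrestrict (x ω, w ω)]
  refine hf.comp (.prodMk (measurable_pi_lambda _ fun v => ?_) (measurable_pi_lambda _ fun v => ?_))
  · by_cases hv : v ∈ V
    · simpa [hv] using hx v hv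
    · simp [hv]
  · by_cases hv : v ∈ E
    · simpa [hv] using hw v hv
    · simp [hv]

theorem iIndepFun_bool {Ω β : Type*} [MeasurableSpace Ω] [MeasurableSpace β] {P : Measure Ω}
    [IsProbabilityMeasure P] {f : Bool → Ω → β} (h : IndepFun (f true) (f false) P) :
    iIndepFun f P := by
  rw [iIndepFun_iff_measure_inter_preimage_eq_mul]
  intro S sets hsets
  have hS : S = ∅ ∨ S = {true} ∨ S = {false} ∨ S = {true, false} := by
    clear hsets
    decide +revert
  rcases hS with rfl | rfl | rfl | rfl
  · simp
  · simp
  · simp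
  · rw [Finset.set_biInter_insert, Finset.set_biInter_singleton, Finset.prod_pair (by simp)]
    exact h.measure_inter_preimage_eq_mul _ _ (hsets true (by simp)) (hsets false (by simp))

instance (a : ℝ) : NullSingletonClass (unif a) :=
  ⟨fun p => cond_absolutelyContinuous (Real.volume_singleton (a := p))⟩

theorem isProbabilityMeasure_unif {a : ℝ} (ha : 0 < a) : IsProbabilityMeasure (unif a) :=
  cond_isProbabilityMeasure_of_finite (by simp [ha]) (by simp)

instance : IsProbabilityMeasure (unif 1) := isProbabilityMeasure_unif one_pos

/-- The offspring number of `q.1` (if `q.2 = false`) or the weight of its edge (if `q.2 = true`). -/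
def coordinate (q : List ℕ × Bool) (c : Config) : ℝ := bif q.2 then c.2 q.1 else c.1 q.1

@[fun_prop]
theorem measurable_coordinate (q : List ℕ × Bool) : Measurable (coordinate q) := by
  obtain ⟨v, _ | _⟩ := q
  · exact (measurable_from_nat (f := ((↑) : ℕ → ℝ))).comp
      (by fun_prop : Measurable fun c : Config => c.1 v)
  · exact (by fun_prop : Measurable fun c : Config => c.2 v)

theorem IsDeterminedBy.comap_le {Ω β : Type*} [MeasurableSpace β] {V E : Set (List ℕ)}
    {f : Config → β} (hfV : IsDeterminedBy V E f) (hf : Measurable f) (X : Ω → List ℕ → ℕ)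
    (U : Ω → List ℕ → ℝ) :
    MeasurableSpace.comap (fun ω => f (X ω, U ω)) inferInstance ≤
      ⨆ q ∈ V ×ˢ {false} ∪ E ×ˢ {true},
        MeasurableSpace.comap (fun ω => coordinate q (X ω, U ω)) inferInstance := by
  have hmeas {q : List ℕ × Bool} (hq : q ∈ V ×ˢ {false} ∪ E ×ˢ {true}) :
      Measurable[⨆ q ∈ V ×ˢ {false} ∪ E ×ˢ {true},
        MeasurableSpace.comap (fun ω => coordinate q (X ω, U ω)) inferInstance]
        fun ω => coordinate q (X ω, U ω) :=
    (comap_measurable _).mono (le_iSup₂_of_le q hq le_rfl) le_rfl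
  refine (hfV.measurable hf (fun v hv => ?_) fun v hv => ?_).comap_le
  · simpa [coordinate, Function.comp_def] using
      Nat.measurable_floor.comp (hmeas (q := (v, false)) (by simp [hv]))
  · exact hmeas (q := (v, true)) (by simp [hv])

namespace IsWeightedBPTree

variable {Ω : Type*} [MeasurableSpace Ω] {P : Measure Ω} {ν : Measure ℕ}
  {X : Ω → List ℕ → ℕ} {U : Ω → List ℕ → ℝ} (h : IsWeightedBPTree P ν X U)
include h

theorem measurable_tree : Measurable X := measurable_pi_lambda _ h.measurable_offspring

theorem measurable_weights : Measurable U := measurable_pi_lambda _ h.measurable_weight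

theorem map_offspring (v : List ℕ) : P.map (fun ω => X ω v) = ν := by
  simpa only [Measure.fst_map_prodMk (h.measurable_weight v), Measure.fst_prod] using
    congrArg Measure.fst (h.law v)

variable [IsProbabilityMeasure ν]

theorem map_weight (v : List ℕ) : P.map (fun ω => U ω v) = unif 1 := by
  simpa only [Measure.snd_map_prodMk (h.measurable_offspring v), Measure.snd_prod] using
    congrArg Measure.snd (h.law v)

variable [IsProbabilityMeasure P]

theorem indepFun_offspring_weight (v : List ℕ) :
    IndepFun (fun ω => X ω v) (fun ω => U ω v) P := by
  rw [indepFun_iff_map_prod_eq_prod_map_map (h.measurable_offspring v).aemeasurable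
    (h.measurable_weight v).aemeasurable, h.law, h.map_offspring, h.map_weight]

theorem iIndepFun_coordinate : iIndepFun (fun q ω => coordinate q (X ω, U ω)) P := by
  have hX := h.measurable_tree
  have hU := h.measurable_weights
  refine iIndepFun_uncurry' (X := fun v b ω => coordinate (v, b) (X ω, U ω)) (by fun_prop) ?_ ?_
  · refine h.indep.comp (fun _ (q : ℕ × ℝ) (b : Bool) => bif b then q.2 else (q.1 : ℝ)) fun _ => ?_
    refine measurable_pi_lambda _ fun b => ?_
    cases b <;> simp only [cond_false, cond_true] <;> fun_prop
  · exact fun v => iIndepFun_bool <|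
      (h.indepFun_offspring_weight v).symm.comp (φ := id) (ψ := ((↑) : ℕ → ℝ))
        measurable_id measurable_from_nat

theorem indepFun {β γ : Type*} [MeasurableSpace β] [MeasurableSpace γ] {f : Config → β}
    {g : Config → γ} {V E V' E' : Set (List ℕ)} (hf : Measurable f) (hg : Measurable g)
    (hfV : IsDeterminedBy V E f) (hgV : IsDeterminedBy V' E' g) (hV : Disjoint V V')
    (hE : Disjoint E E') : IndepFun (fun ω => f (X ω, U ω)) (fun ω => g (X ω, U ω)) P := by
  have hdisj : Disjoint (V ×ˢ {false} ∪ E ×ˢ {true}) (V' ×ˢ {false} ∪ E' ×ˢ {true}) := by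
    simp [Set.disjoint_prod, hV, hE]
  have hX := h.measurable_tree
  have hU := h.measurable_weights
  have hcoord (q : List ℕ × Bool) : Measurable fun ω => coordinate q (X ω, U ω) := by fun_prop
  have hindep := indep_iSup_of_disjoint (fun q => (hcoord q).comap_le)
    ((iIndepFun_iff_iIndep _ _ _).1 h.iIndepFun_coordinate) hdisj
  exact (IndepFun_iff_Indep _ _ _).2 <| indep_of_indep_of_le_left
    (indep_of_indep_of_le_right hindep (hgV.comap_le hg X U)) (hfV.comap_le hf X U)

theorem measureReal_and {p q : Config → Prop} {V E V' E' : Set (List ℕ)} (hp : Measurable p)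
    (hq : Measurable q) (hpV : IsDeterminedBy V E p) (hqV : IsDeterminedBy V' E' q)
    (hV : Disjoint V V') (hE : Disjoint E E') :
    P.real {ω | p (X ω, U ω) ∧ q (X ω, U ω)} =
      P.real {ω | p (X ω, U ω)} * P.real {ω | q (X ω, U ω)} := by
  have := (h.indepFun hp hq hpV hqV hV hE).measure_inter_preimage_eq_mul {True} {True}
    trivial trivial
  simpa [measureReal_def, Set.preimage, Set.inter_def] using congrArg ENNReal.toReal this

end IsWeightedBPTree

/-! ### Survival probabilities -/

/-- The probability that at least one child is kept when every child is kept independently with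
probability `q`. -/
noncomputable def keepProb (ν : Measure ℕ) (q : ℝ) : ℝ := 1 - ∫ n, (1 - q) ^ n ∂ν

theorem one_sub_mul_pow_le {q r : ℝ} (hq : q ≤ 1) (hr : r ∈ Set.Icc (0 : ℝ) 1) (n : ℕ) :
    (1 - r * q) ^ n ≤ (1 - r) + r * (1 - q) ^ n := by
  have := (convexOn_pow n).2 (show (1 : ℝ) ∈ Set.Ici 0 by simp)
    (show 1 - q ∈ Set.Ici (0 : ℝ) by simp [hq]) (sub_nonneg.2 hr.2) hr.1 (by ring)
  simp only [smul_eq_mul, one_pow, mul_one] at this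
  rwa [show 1 - r + r * (1 - q) = 1 - r * q by ring] at this

theorem one_sub_mul_pow_lt {q r : ℝ} (hq : q ∈ Set.Ioc (0 : ℝ) 1) (hr : r ∈ Set.Ioo (0 : ℝ) 1)
    {n : ℕ} (hn : 2 ≤ n) : (1 - r * q) ^ n < (1 - r) + r * (1 - q) ^ n := by
  have := (strictConvexOn_pow hn).2 (show (1 : ℝ) ∈ Set.Ici 0 by simp)
    (show 1 - q ∈ Set.Ici (0 : ℝ) by simp [hq.2]) (by linarith [hq.1]) (sub_pos.2 hr.2) hr.1
    (by ring)
  simp only [smul_eq_mul, one_pow, mul_one] at this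
  rwa [show 1 - r + r * (1 - q) = 1 - r * q by ring] at this

section

variable {ν : Measure ℕ} [IsProbabilityMeasure ν]

theorem norm_one_sub_pow_le_one {q : ℝ} (hq : q ∈ Set.Icc (0 : ℝ) 1) (n : ℕ) :
    ‖(1 - q) ^ n‖ ≤ 1 := by
  rw [Real.norm_of_nonneg (pow_nonneg (by linarith [hq.2]) n)]
  exact pow_le_one₀ (by linarith [hq.2]) (by linarith [hq.1])

theorem integrable_one_sub_pow {q : ℝ} (hq : q ∈ Set.Icc (0 : ℝ) 1) :
    Integrable (fun n : ℕ => (1 - q) ^ n) ν :=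
  .of_bound (measurable_of_countable _).aestronglyMeasurable 1
    (ae_of_all _ (norm_one_sub_pow_le_one hq))

theorem keepProb_zero : keepProb ν 0 = 0 := by simp [keepProb]

theorem monotoneOn_keepProb : MonotoneOn (keepProb ν) (Set.Icc 0 1) := fun q hq r hr hqr =>
  sub_le_sub_left (integral_mono (integrable_one_sub_pow hr) (integrable_one_sub_pow hq)
    fun n => pow_le_pow_left₀ (by linarith [hr.2]) (by linarith) n) _

theorem continuousOn_keepProb : ContinuousOn (keepProb ν) (Set.Icc 0 1) :=
  continuousOn_const.sub <| continuousOn_of_dominated (bound := fun _ => 1)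
    (fun _ _ => (measurable_of_countable _).aestronglyMeasurable)
    (fun _ hq => ae_of_all _ (norm_one_sub_pow_le_one hq)) (integrable_const _)
    (ae_of_all _ fun _ => by fun_prop)

theorem mul_keepProb_lt (hν : ν {n | 2 ≤ n} ≠ 0) {q r : ℝ} (hq : q ∈ Set.Ioc (0 : ℝ) 1)
    (hr : r ∈ Set.Ioo (0 : ℝ) 1) : r * keepProb ν q < keepProb ν (r * q) := by
  have hrq := integrable_one_sub_pow (ν := ν) (q := r * q)
    ⟨mul_nonneg hr.1.le hq.1.le, mul_le_one₀ hr.2.le hq.1.le hq.2⟩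
  have hq' := (integrable_one_sub_pow (ν := ν) ⟨hq.1.le, hq.2⟩).const_mul r
  have hadd : Integrable (fun n : ℕ => (1 - r) + r * (1 - q) ^ n) ν := (integrable_const _).add hq'
  have hpos : 0 < ∫ n : ℕ, ((1 - r) + r * (1 - q) ^ n - (1 - r * q) ^ n) ∂ν := by
    refine (integral_pos_iff_support_of_nonneg (fun n => sub_nonneg.2 <|
      one_sub_mul_pow_le hq.2 ⟨hr.1.le, hr.2.le⟩ n) (hadd.sub hrq)).2 ?_
    exact (pos_iff_ne_zero.2 hν).trans_le <|
      measure_mono fun n hn => (sub_pos.2 (one_sub_mul_pow_lt hq hr hn)).ne'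
  rw [integral_sub hadd hrq, integral_add (integrable_const _) hq', integral_const_mul,
    integral_const, probReal_univ, one_smul] at hpos
  rw [keepProb, keepProb]
  linarith

/-- By strict concavity, `t ↦ keepProb ν (q * t)` lies above the diagonal to the left of its
positive fixed point. -/
theorem lt_keepProb_mul (hν : ν {n | 2 ≤ n} ≠ 0) {q s t : ℝ} (hq : q ∈ Set.Icc (0 : ℝ) 1)
    (hs : s ≤ 1) (hfix : keepProb ν (q * s) = s) (ht : 0 < t) (hts : t < s) :
    t < keepProb ν (q * t) := by
  have hs0 : 0 < s := ht.trans hts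
  have hq0 : q ≠ 0 := by
    rintro rfl
    rw [zero_mul, keepProb_zero] at hfix
    exact hs0.ne hfix
  have := mul_keepProb_lt hν
    ⟨mul_pos (hq.1.lt_of_ne' hq0) hs0, mul_le_one₀ hq.2 hs0.le hs⟩
    ⟨div_pos ht hs0, (div_lt_one hs0).2 hts⟩
  rwa [hfix, div_mul_cancel₀ _ hs0.ne', mul_left_comm, div_mul_cancel₀ _ hs0.ne'] at this

end

theorem cdf_unif_one (p : ℝ) : cdf (unif 1) p = max 0 (min p 1) := by
  have hinter : Set.Icc 0 1 ∩ Set.Iic p = Set.Icc 0 (min 1 p) := by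
    rw [← Set.Ici_inter_Iic, Set.inter_assoc, Set.Iic_inter_Iic, Set.Ici_inter_Iic]
  rw [cdf_eq_real, unif, measureReal_def, cond_apply measurableSet_Icc, hinter, ENNReal.toReal_mul,
    ← measureReal_def, Real.volume_real_Icc]
  simp [max_comm, min_comm]

theorem continuous_cdf_unif_one : Continuous (cdf (unif 1)) := by
  rw [funext cdf_unif_one]
  fun_prop

theorem cdf_mul_mem_Icc {μ : Measure ℝ} {p s : ℝ} (hs : s ∈ Set.Icc (0 : ℝ) 1) :
    cdf μ p * s ∈ Set.Icc (0 : ℝ) 1 :=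
  ⟨mul_nonneg (cdf_nonneg μ p) hs.1, mul_le_one₀ (cdf_le_one μ p) hs.1 hs.2⟩

theorem IsDeterminedBy.mono {β : Type*} {V E V' E' : Set (List ℕ)} {f : Config → β}
    (hf : IsDeterminedBy V E f) (hV : V ⊆ V') (hE : E ⊆ E') : IsDeterminedBy V' E' f :=
  fun _ _ h₁ h₂ => hf _ _ (h₁.mono hV) (h₂.mono hE)

theorem isDeterminedBy_thresholdAux (n : ℕ) (v : List ℕ) :
    IsDeterminedBy {y | v <:+ y} {y | v <:+ y ∧ y ≠ v} fun c => thresholdAux c.1 c.2 n v :=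
  fun _ _ hx hw => thresholdAux_congr n (fun _ hy => hx hy) fun _ hy hne => hw ⟨hy, hne⟩

namespace IsWeightedBPTree

variable {Ω : Type*} [MeasurableSpace Ω] {P : Measure Ω} [IsProbabilityMeasure P]
  {ν : Measure ℕ} [IsProbabilityMeasure ν] {X : Ω → List ℕ → ℕ} {U : Ω → List ℕ → ℝ}
  (h : IsWeightedBPTree P ν X U)
include h

omit [IsProbabilityMeasure P] in
theorem measureReal_weight_le (v : List ℕ) (p : ℝ) : P.real {ω | U ω v ≤ p} = cdf (unif 1) p := by
  rw [cdf_eq_real, ← h.map_weight v,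
    map_measureReal_apply (h.measurable_weight v) measurableSet_Iic]
  rfl

theorem measureReal_lt_max_thresholdAux (n : ℕ) (v : List ℕ) (p : ℝ) :
    P.real {ω | (p : EReal) < max (U ω v : EReal) (thresholdAux (X ω) (U ω) n v)} =
      1 - cdf (unif 1) p * P.real {ω | thresholdAux (X ω) (U ω) n v ≤ p} := by
  have hX := h.measurable_tree
  have hU := h.measurable_weights
  have hset : {ω | (p : EReal) < max (U ω v : EReal) (thresholdAux (X ω) (U ω) n v)} =
      {ω | U ω v ≤ p ∧ thresholdAux (X ω) (U ω) n v ≤ p}ᶜ := by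
    ext ω
    simp only [Set.mem_ofPred_eq, Set.mem_compl_iff, not_and_or, not_le, lt_max_iff,
      EReal.coe_lt_coe_iff]
  have hmul := h.measureReal_and (p := fun c => c.2 v ≤ p)
    (q := fun c => thresholdAux c.1 c.2 n v ≤ p) (V := ∅) (E := {v}) (V' := Set.univ) (E' := {v}ᶜ)
    (.le' (by fun_prop) (by fun_prop)) (.le' (by fun_prop) (by fun_prop))
    (fun c c' _ hw => by simp only [hw rfl])
    (fun c c' hx hw => congrArg (· ≤ (p : EReal)) <|
      isDeterminedBy_thresholdAux n v c c' (hx.mono (Set.subset_univ _)) (hw.mono fun _ hy => hy.2))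
    (Set.empty_disjoint _) disjoint_compl_right
  rw [hset, probReal_compl_eq_one_sub (measurableSet_setOfPred.2 <|
    .and (.le' (by fun_prop) (by fun_prop)) (.le' (by fun_prop) (by fun_prop))), hmul,
    h.measureReal_weight_le]

theorem measureReal_offspring_eq_and_forall (v : List ℕ) (n N M : ℕ) (p s : ℝ)
    (hs : ∀ i, P.real {ω | (p : EReal) <
      max (U ω (i :: v) : EReal) (thresholdAux (X ω) (U ω) n (i :: v))} = s) :
    P.real {ω | X ω v = N ∧ ∀ i < M, (p : EReal) <
      max (U ω (i :: v) : EReal) (thresholdAux (X ω) (U ω) n (i :: v))} = ν.real {N} * s ^ M := by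
  induction M with
  | zero =>
    simp only [not_lt_zero, IsEmpty.forall_iff, implies_true, and_true, pow_zero, mul_one]
    rw [← h.map_offspring v,
      map_measureReal_apply (h.measurable_offspring v) (measurableSet_singleton N)]
    rfl
  | succ M ih =>
    have hdet (i : ℕ) : IsDeterminedBy {y | i :: v <:+ y} {y | i :: v <:+ y} fun c =>
        (p : EReal) < max (c.2 (i :: v) : EReal) (thresholdAux c.1 c.2 n (i :: v)) :=
      fun c c' hx hw => by
        simp only [hw List.suffix_rfl, isDeterminedBy_thresholdAux n (i :: v) c c' hx
          (hw.mono fun _ hy => hy.1)]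
    have hmeas (i : ℕ) : Measurable fun c : Config =>
        (p : EReal) < max (c.2 (i :: v) : EReal) (thresholdAux c.1 c.2 n (i :: v)) :=
      .lt (by fun_prop) (.max (by fun_prop) (by fun_prop))
    have hsub {i : ℕ} (hi : i < M) : {y | i :: v <:+ y} ⊆ {y | M :: v <:+ y}ᶜ :=
      fun y hy hy' => hi.ne (eq_of_cons_suffix hy hy')
    have hmul := h.measureReal_and (V := {y | M :: v <:+ y}ᶜ) (E := {y | M :: v <:+ y}ᶜ)
      (p := fun c => c.1 v = N ∧ ∀ i < M, (p : EReal) <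
        max (c.2 (i :: v) : EReal) (thresholdAux c.1 c.2 n (i :: v)))
      (.and (.eq (by fun_prop) (by fun_prop)) (.forall fun i => measurable_const.imp (hmeas i)))
      (hmeas M)
      (fun c c' hx hw => by
        simp only [hx (not_cons_suffix_of_suffix List.suffix_rfl)]
        exact congrArg _ (forall₂_congr fun i hi =>
          ((hdet i).mono (hsub hi) (hsub hi) c c' hx hw).to_iff).eq)
      (hdet M) disjoint_compl_left disjoint_compl_left
    rw [ih, hs M, mul_assoc, ← pow_succ] at hmul
    simpa only [Nat.forall_lt_succ_right, and_assoc] using hmul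

theorem measureReal_thresholdAux_succ (v : List ℕ) (n : ℕ) (p s : ℝ)
    (hs : ∀ i, P.real {ω | thresholdAux (X ω) (U ω) n (i :: v) ≤ p} = s) :
    P.real {ω | thresholdAux (X ω) (U ω) (n + 1) v ≤ p} = keepProb ν (cdf (unif 1) p * s) := by
  have hX := h.measurable_tree
  have hU := h.measurable_weights
  let E (N : ℕ) : Set Ω := {ω | X ω v = N ∧ ∀ i < N, (p : EReal) <
      max (U ω (i :: v) : EReal) (thresholdAux (X ω) (U ω) n (i :: v))}
  have hE (N : ℕ) : MeasurableSet (E N) := measurableSet_setOfPred.2 <|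
    .and (.eq (by fun_prop) (by fun_prop)) <| .forall fun i => measurable_const.imp <|
      .lt (by fun_prop) (.max (by fun_prop) (by fun_prop))
  have hset : {ω | thresholdAux (X ω) (U ω) (n + 1) v ≤ p}ᶜ = ⋃ N, E N := by
    ext ω
    simp only [Set.mem_compl_iff, Set.mem_ofPred_eq, not_le, Set.mem_iUnion, E, thresholdAux,
      Finset.lt_inf_iff (EReal.coe_lt_top p), Finset.mem_range, exists_eq_left']
  have hdisj : Pairwise (Function.onFun Disjoint E) := fun N M hNM =>
    Set.disjoint_left.2 fun ω h₁ h₂ => hNM (h₁.1.symm.trans h₂.1)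
  have hprob (N : ℕ) : P.real (E N) = ν.real {N} * (1 - cdf (unif 1) p * s) ^ N :=
    h.measureReal_offspring_eq_and_forall v n N N p _ fun i => by
      rw [h.measureReal_lt_max_thresholdAux, hs]
  have hsI : s ∈ Set.Icc (0 : ℝ) 1 := hs 0 ▸ ⟨measureReal_nonneg, measureReal_le_one⟩
  have hcompl : P.real {ω | thresholdAux (X ω) (U ω) (n + 1) v ≤ p}ᶜ =
      ∫ N, (1 - cdf (unif 1) p * s) ^ N ∂ν := by
    rw [hset, measureReal_def, measure_iUnion hdisj hE,
      ENNReal.tsum_toReal_eq fun N => measure_ne_top _ _,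
      integral_countable (integrable_one_sub_pow (cdf_mul_mem_Icc hsI))]
    exact tsum_congr hprob
  rw [keepProb, ← hcompl, probReal_compl_eq_one_sub
    (measurableSet_setOfPred.2 (.le' (by fun_prop) (by fun_prop))), sub_sub_cancel]

theorem measureReal_thresholdAux (v : List ℕ) (n : ℕ) (p : ℝ) :
    P.real {ω | thresholdAux (X ω) (U ω) n v ≤ p} =
      (fun s => keepProb ν (cdf (unif 1) p * s))^[n] 1 := by
  induction n generalizing v with
  | zero => simp [thresholdAux]
  | succ n ih =>
    rw [h.measureReal_thresholdAux_succ v n p _ fun i => ih (i :: v), Function.iterate_succ_apply']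

theorem measureReal_thresholdAux_succ' (v : List ℕ) (n : ℕ) (p : ℝ) :
    P.real {ω | thresholdAux (X ω) (U ω) (n + 1) v ≤ p} =
      keepProb ν (cdf (unif 1) p * P.real {ω | thresholdAux (X ω) (U ω) n v ≤ p}) := by
  rw [h.measureReal_thresholdAux, h.measureReal_thresholdAux, Function.iterate_succ_apply']

omit [IsProbabilityMeasure ν] in
theorem tendsto_measureReal_thresholdAux (v : List ℕ) (p : ℝ) :
    Tendsto (fun n => P.real {ω | thresholdAux (X ω) (U ω) n v ≤ p}) atTop
      (𝓝 (P.real {ω | threshold (X ω) (U ω) v ≤ p})) := by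
  have hX := h.measurable_tree
  have hU := h.measurable_weights
  have hset : {ω | threshold (X ω) (U ω) v ≤ p} =
      ⋂ n, {ω | thresholdAux (X ω) (U ω) n v ≤ p} := by
    ext ω
    simp [threshold]
  rw [hset]
  refine (ENNReal.tendsto_toReal (measure_ne_top _ _)).comp (tendsto_measure_iInter_atTop
    (fun n => (measurableSet_setOfPred.2 (.le' (by fun_prop) (by fun_prop))).nullMeasurableSet)
    (fun m n hmn ω hω => (thresholdAux_mono v hmn).trans hω) ⟨0, measure_ne_top _ _⟩)

theorem keepProb_measureReal_threshold_le (v : List ℕ) (p : ℝ) :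
    keepProb ν (cdf (unif 1) p * P.real {ω | threshold (X ω) (U ω) v ≤ p}) =
      P.real {ω | threshold (X ω) (U ω) v ≤ p} := by
  have hlim := h.tendsto_measureReal_thresholdAux v p
  refine tendsto_nhds_unique ?_ (hlim.comp (tendsto_add_atTop_nat 1))
  simp only [Function.comp_def, h.measureReal_thresholdAux_succ']
  exact (continuousOn_keepProb _ (cdf_mul_mem_Icc ⟨measureReal_nonneg, measureReal_le_one⟩)).tendsto
    |>.comp <| tendsto_nhdsWithin_iff.2 ⟨hlim.const_mul _, .of_forall fun n =>
      cdf_mul_mem_Icc ⟨measureReal_nonneg, measureReal_le_one⟩⟩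

theorem le_measureReal_threshold_le {p t : ℝ} (ht : t ∈ Set.Icc (0 : ℝ) 1)
    (hle : t ≤ keepProb ν (cdf (unif 1) p * t)) (v : List ℕ) :
    t ≤ P.real {ω | threshold (X ω) (U ω) v ≤ p} := by
  refine ge_of_tendsto' (h.tendsto_measureReal_thresholdAux v p) fun n => ?_
  induction n with
  | zero => simpa [thresholdAux] using ht.2
  | succ n ih =>
    rw [h.measureReal_thresholdAux_succ']
    exact hle.trans <| monotoneOn_keepProb (cdf_mul_mem_Icc ht)
      (cdf_mul_mem_Icc ⟨measureReal_nonneg, measureReal_le_one⟩)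
      (mul_le_mul_of_nonneg_left ih (cdf_nonneg _ p))

/-- If `0 < t < s = P (threshold ≤ p)`, then `t` is below its image under the recursion for the
level `p`, hence also for some level `p' < p`, so that `t ≤ P (threshold ≤ p')`. -/
theorem measureReal_threshold_le_le_lt (hν : ν {n | 2 ≤ n} ≠ 0) (v : List ℕ) (p : ℝ) :
    P.real {ω | threshold (X ω) (U ω) v ≤ p} ≤ P.real {ω | threshold (X ω) (U ω) v < p} := by
  refine le_of_forall_lt_imp_le_of_dense fun t hts => ?_
  rcases le_or_gt t 0 with ht | ht
  · exact ht.trans measureReal_nonneg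
  have htI : t ∈ Set.Icc (0 : ℝ) 1 := ⟨ht.le, hts.le.trans measureReal_le_one⟩
  have hlt : t < keepProb ν (cdf (unif 1) p * t) :=
    lt_keepProb_mul hν ⟨cdf_nonneg _ p, cdf_le_one _ p⟩ measureReal_le_one
      (h.keepProb_measureReal_threshold_le v p) ht hts
  have hcont : Continuous fun p' => keepProb ν (cdf (unif 1) p' * t) :=
    continuousOn_keepProb.comp_continuous (continuous_cdf_unif_one.mul_const t)
      fun p' => cdf_mul_mem_Icc htI
  obtain ⟨p', hp', hp'p⟩ : ∃ p', t < keepProb ν (cdf (unif 1) p' * t) ∧ p' < p :=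
    (((hcont.tendsto p).mono_left nhdsWithin_le_nhds).eventually (lt_mem_nhds hlt)
      |>.and self_mem_nhdsWithin).exists (f := 𝓝[<] p)
  exact (h.le_measureReal_threshold_le htI hp'.le v).trans <|
    measureReal_mono fun ω hω => lt_of_le_of_lt hω (EReal.coe_lt_coe_iff.2 hp'p)

theorem measure_threshold_eq (hν : ν {n | 2 ≤ n} ≠ 0) (v : List ℕ) (p : ℝ) :
    P {ω | threshold (X ω) (U ω) v = p} = 0 := by
  have hX := h.measurable_tree
  have hU := h.measurable_weights
  have hlt : MeasurableSet {ω | threshold (X ω) (U ω) v < p} :=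
    measurableSet_setOfPred.2 (.lt (by fun_prop) (by fun_prop))
  have hset : {ω | threshold (X ω) (U ω) v = p} =
      {ω | threshold (X ω) (U ω) v ≤ p} \ {ω | threshold (X ω) (U ω) v < p} := by
    ext ω
    simp only [Set.mem_ofPred_eq, Set.mem_sdiff, not_lt, le_antisymm_iff]
  have hsub : {ω | threshold (X ω) (U ω) v < p} ⊆ {ω | threshold (X ω) (U ω) v ≤ p} :=
    fun ω (hω : threshold (X ω) (U ω) v < p) => hω.le
  rw [hset, measure_sdiff hsub hlt.nullMeasurableSet (measure_ne_top _ _),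
    tsub_eq_zero_iff_le]
  exact (ENNReal.toReal_le_toReal (measure_ne_top _ _) (measure_ne_top _ _)).1
    (h.measureReal_threshold_le_le_lt hν v p)

end IsWeightedBPTree

/-! ### Almost sure regularity -/

theorem ae_ne_of_indepFun {Ω β : Type*} [MeasurableSpace Ω] {P : Measure Ω} [IsFiniteMeasure P]
    [MeasurableSpace β] [MeasurableEq β] {f g : Ω → β} (hf : Measurable f) (hg : Measurable g)
    (h : IndepFun f g P) (hatom : ∀ b, P {ω | f ω = b} = 0) : ∀ᵐ ω ∂P, f ω ≠ g ω := by
  have hdiag : MeasurableSet {q : β × β | q.2 = q.1} :=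
    measurableSet_eq_fun measurable_snd measurable_fst
  have hnull : (P.map g).prod (P.map f) {q : β × β | q.2 = q.1} = 0 := by
    refine (Measure.measure_prod_null hdiag).2 (ae_of_all _ fun b => ?_)
    change P.map f (Prod.mk b ⁻¹' _) = 0
    rw [Measure.map_apply hf (measurable_prodMk_left hdiag)]
    exact hatom b
  rw [← (indepFun_iff_map_prod_eq_prod_map_map hg.aemeasurable hf.aemeasurable).1 h.symm,
    Measure.map_apply (hg.prodMk hf) hdiag] at hnull
  exact measure_eq_zero_iff_ae_notMem.1 hnull

theorem isDeterminedBy_threshold (v : List ℕ) :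
    IsDeterminedBy {y | v <:+ y} {y | v <:+ y} fun c => threshold c.1 c.2 v :=
  fun _ _ hx hw => threshold_congr (fun _ hy => hx hy) fun _ hy _ => hw hy

theorem isDeterminedBy_branchThreshold (v : List ℕ) :
    IsDeterminedBy {y | v <:+ y} {y | v <:+ y} fun c => branchThreshold c.1 c.2 v :=
  fun _ _ hx hw => branchThreshold_congr (fun _ hy => hx hy) fun _ hy => hw hy

namespace IsWeightedBPTree

variable {Ω : Type*} [MeasurableSpace Ω] {P : Measure Ω} {ν : Measure ℕ}
  {X : Ω → List ℕ → ℕ} {U : Ω → List ℕ → ℝ} (h : IsWeightedBPTree P ν X U)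
include h

theorem ae_forall_offspring {p : ℕ → Prop} (hp : ∀ᵐ n ∂ν, p n) : ∀ᵐ ω ∂P, ∀ v, p (X ω v) :=
  ae_all_iff.2 fun v =>
    ae_of_ae_map (h.measurable_offspring v).aemeasurable (by rwa [h.map_offspring])

variable [IsProbabilityMeasure ν]

theorem measure_weight_eq (v : List ℕ) (p : ℝ) : P {ω | U ω v = p} = 0 := by
  rw [← measure_singleton (μ := unif 1) p, ← h.map_weight v,
    Measure.map_apply (h.measurable_weight v) (measurableSet_singleton p)]
  rfl

theorem measure_coe_weight_eq (v : List ℕ) (b : EReal) : P {ω | (U ω v : EReal) = b} = 0 := by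
  induction b with
  | bot => simp
  | top => simp
  | coe p => simpa using h.measure_weight_eq v p

theorem ae_weight_mem_Ioc : ∀ᵐ ω ∂P, ∀ v, U ω v ∈ Set.Ioc (0 : ℝ) 1 := by
  refine ae_all_iff.2 fun v => ?_
  have hIcc : ∀ᵐ r ∂(P.map fun ω => U ω v), r ∈ Set.Icc (0 : ℝ) 1 := by
    rw [h.map_weight, unif]
    exact ae_cond_mem measurableSet_Icc
  filter_upwards [ae_of_ae_map (h.measurable_weight v).aemeasurable hIcc,
    measure_eq_zero_iff_ae_notMem.1 (h.measure_weight_eq v 0)] with ω hmem hne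
  exact ⟨hmem.1.lt_of_ne' hne, hmem.2⟩

variable [IsProbabilityMeasure P]

theorem ae_injective_weight : ∀ᵐ ω ∂P, Function.Injective (U ω) := by
  have hne : ∀ᵐ ω ∂P, ∀ y z, y ≠ z → U ω y ≠ U ω z := by
    simp only [ae_all_iff]
    exact fun y z hyz => ae_ne_of_indepFun (h.measurable_weight y) (h.measurable_weight z)
      ((h.indep.indepFun hyz).comp measurable_snd measurable_snd) (h.measure_weight_eq y)
  filter_upwards [hne] with ω hω y z
  exact not_imp_not.1 (hω y z)

theorem ae_threshold_ne : ∀ᵐ ω ∂P, ∀ y z, ¬ z <:+ y → threshold (X ω) (U ω) z ≠ U ω y := by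
  have hX := h.measurable_tree
  have hU := h.measurable_weights
  simp only [ae_all_iff]
  intro y z hyz
  have hindep := h.indepFun (f := fun c => (c.2 y : EReal)) (g := fun c => threshold c.1 c.2 z)
    (V := ∅) (E := {y}) (by fun_prop) (by fun_prop) (fun c c' _ hw => by simp only [hw rfl])
    (isDeterminedBy_threshold z) (Set.empty_disjoint _) (Set.disjoint_singleton_left.2 hyz)
  exact (ae_ne_of_indepFun (by fun_prop) (by fun_prop) hindep (h.measure_coe_weight_eq y)).mono
    fun _ => Ne.symm

theorem measure_branchThreshold_eq (hν₀ : ν {0} = 0) (hν : ν {n | 2 ≤ n} ≠ 0) (v : List ℕ)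
    (b : EReal) : P {ω | branchThreshold (X ω) (U ω) v = b} = 0 := by
  induction b with
  | bot => simp [branchThreshold]
  | top =>
    refine measure_eq_zero_iff_ae_notMem.2 ?_
    filter_upwards [h.ae_forall_offspring (p := (1 ≤ ·)) (by simpa [ae_iff] using hν₀),
      h.ae_weight_mem_Ioc] with ω hx hw
    have hthreshold := threshold_le_of_forall_le hx (fun v => (hw v).2) v
    exact (max_lt (EReal.coe_lt_top _) (hthreshold.trans_lt (EReal.coe_lt_top 1))).ne
  | coe p =>
    refine measure_mono_null (t := {ω | (U ω v : EReal) = p} ∪ {ω | threshold (X ω) (U ω) v = p})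
      (fun ω (hω : max (U ω v : EReal) (threshold (X ω) (U ω) v) = p) => ?_)
      (measure_union_null (h.measure_coe_weight_eq v p) (h.measure_threshold_eq hν v p))
    rcases max_choice (U ω v : EReal) (threshold (X ω) (U ω) v) with hmax | hmax
    exacts [Or.inl (hmax.symm.trans hω), Or.inr (hmax.symm.trans hω)]

theorem ae_branchThreshold_ne (hν₀ : ν {0} = 0) (hν : ν {n | 2 ≤ n} ≠ 0) :
    ∀ᵐ ω ∂P, ∀ v i j, i ≠ j →
      branchThreshold (X ω) (U ω) (i :: v) ≠ branchThreshold (X ω) (U ω) (j :: v) := by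
  have hX := h.measurable_tree
  have hU := h.measurable_weights
  simp only [ae_all_iff]
  intro v i j hij
  have hdisj : Disjoint {y | i :: v <:+ y} {y | j :: v <:+ y} :=
    Set.disjoint_left.2 fun y hi hj => hij (eq_of_cons_suffix hi hj)
  exact ae_ne_of_indepFun (by fun_prop) (by fun_prop)
    (h.indepFun (f := fun c => branchThreshold c.1 c.2 (i :: v))
      (g := fun c => branchThreshold c.1 c.2 (j :: v)) (by fun_prop) (by fun_prop)
      (isDeterminedBy_branchThreshold _) (isDeterminedBy_branchThreshold _) hdisj hdisj)
    (h.measure_branchThreshold_eq hν₀ hν _)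

theorem ae_isRegular (hν₀ : ν {0} = 0) : ∀ᵐ ω ∂P, IsRegular (X ω) (U ω) := by
  have hbranch : ∀ᵐ ω ∂P, ∀ v i j, i < X ω v → j < X ω v → i ≠ j →
      branchThreshold (X ω) (U ω) (i :: v) ≠ branchThreshold (X ω) (U ω) (j :: v) := by
    by_cases hν : ν {n | 2 ≤ n} = 0
    · filter_upwards [h.ae_forall_offspring (measure_eq_zero_iff_ae_notMem.1 hν)]
        with ω hω v i j hi hj hij
      have : ¬ 2 ≤ X ω v := hω v
      omega
    · filter_upwards [h.ae_branchThreshold_ne hν₀ hν] with ω hω v i j _ _ hij using hω v i j hij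
  filter_upwards [h.ae_forall_offspring (p := (1 ≤ ·)) (by simpa [ae_iff] using hν₀),
    h.ae_weight_mem_Ioc, h.ae_injective_weight, hbranch, h.ae_threshold_ne] with ω hx hw hinj hb ht
  exact ⟨hx, fun v => (hw v).1, fun v => (hw v).2, hinj, hb, ht⟩

end IsWeightedBPTree

/-! ### Conditional distributions -/

section HasCondDistrib

variable {Ω β γ δ : Type*} [MeasurableSpace Ω] [MeasurableSpace β] [MeasurableSpace γ]
  [MeasurableSpace δ] {μ : Measure Ω} {X : Ω → β} {Y : Ω → γ} {κ : Kernel β γ}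

theorem hasCondDistrib_congr {X' : Ω → β} {Y' : Ω → γ} (h : HasCondDistrib Y X κ μ)
    (hX : X' =ᵐ[μ] X) (hY : Y' =ᵐ[μ] Y) : HasCondDistrib Y' X' κ μ := by
  rw [HasCondDistrib, Measure.map_congr hX]
  exact HasLaw.congr h (hX.prodMk hY)

theorem hasCondDistrib_smul_measure [SFinite μ] [IsSFiniteKernel κ]
    (h : HasCondDistrib Y X κ μ) (a : ℝ≥0∞) :
    HasCondDistrib Y X κ (a • μ) where
  aemeasurable := h.aemeasurable.smul_measure a
  map_eq := by
    rw [Measure.map_smul, Measure.map_smul, h.map_eq, Measure.compProd_smul_left]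

theorem hasCondDistrib_sum_measure {ι : Type*} [Countable ι] {μ : ι → Measure Ω}
    [∀ i, SFinite (μ i)] (h : ∀ i, HasCondDistrib Y X κ (μ i)) :
    HasCondDistrib Y X κ (Measure.sum μ) where
  aemeasurable := aemeasurable_sum_measure_iff.2 fun i => (h i).aemeasurable
  map_eq := by
    rw [Measure.map_sum (aemeasurable_sum_measure_iff.2 fun i => (h i).aemeasurable),
      Measure.map_sum (aemeasurable_sum_measure_iff.2 fun i => (h i).aemeasurable_fst),
      Measure.compProd_sum_left]
    exact congrArg Measure.sum (funext fun i => (h i).map_eq)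

theorem hasCondDistrib_prodMk {Z : Ω → δ} {η : Kernel (β × γ) δ}
    (hY : HasCondDistrib Y X κ μ) (hZ : HasCondDistrib Z (fun ω => (X ω, Y ω)) η μ) :
    HasCondDistrib (fun ω => (Y ω, Z ω)) X (κ ⊗ₖ η) μ where
  aemeasurable := by
    have := hZ.aemeasurable_snd
    have := hY.aemeasurable_fst
    have := hY.aemeasurable_snd
    fun_prop
  map_eq := by
    rw [← Measure.compProd_assoc', ← hY.map_eq, ← hZ.map_eq,
      AEMeasurable.map_map_of_aemeasurable (by fun_prop) hZ.aemeasurable]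
    rfl

theorem condDistrib_ae_eq_of_hasCondDistrib [IsFiniteMeasure μ] [StandardBorelSpace γ] [Nonempty γ]
    {κ : Kernel β γ} [IsFiniteKernel κ] (h : HasCondDistrib Y X κ μ) :
    condDistrib Y X μ =ᵐ[μ.map X] κ :=
  condDistrib_ae_eq_of_measure_eq_compProd X h.aemeasurable_snd h.map_eq

theorem hasCondDistrib_condDistrib [IsFiniteMeasure μ] [StandardBorelSpace γ] [Nonempty γ]
    (hX : AEMeasurable X μ) (hY : AEMeasurable Y μ) :
    HasCondDistrib Y X (condDistrib Y X μ) μ :=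
  ⟨hX.prodMk hY, (compProd_map_condDistrib hY).symm⟩

/-- Rejection sampling: the proposal `Y` is accepted if `(X, Y)` lies in `E`. -/
theorem hasCondDistrib_restrict_of_indepFun [IsFiniteMeasure μ] [IsSFiniteKernel κ]
    (hX : Measurable X) (hY : Measurable Y) (hXY : IndepFun X Y μ)
    {E : Set (β × γ)} (hE : MeasurableSet E)
    (hκ : ∀ b, (μ.map Y).restrict (Prod.mk b ⁻¹' E) = μ.map Y (Prod.mk b ⁻¹' E) • κ b) :
    HasCondDistrib Y X κ (μ.restrict {ω | (X ω, Y ω) ∈ E}) where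
  aemeasurable := (hX.prodMk hY).aemeasurable
  map_eq := by
    have hpair := hX.prodMk hY
    have hlaw : (μ.restrict {ω | (X ω, Y ω) ∈ E}).map (fun ω => (X ω, Y ω)) =
        ((μ.map X).prod (μ.map Y)).restrict E := by
      rw [← (indepFun_iff_map_prod_eq_prod_map_map hX.aemeasurable hY.aemeasurable).1 hXY,
        Measure.restrict_map hpair hE]
      rfl
    have hfst := Measure.fst_map_prodMk (X := X) (μ := μ.restrict {ω | (X ω, Y ω) ∈ E}) hY
    ext s hs
    have hslice (b : β) (z : γ) : E.indicator (fun q => κ q.1 (Prod.mk q.1 ⁻¹' s)) (b, z) =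
        (Prod.mk b ⁻¹' E).indicator (fun _ => κ b (Prod.mk b ⁻¹' s)) z := rfl
    have hker : Measurable fun q : β × γ => κ q.1 (Prod.mk q.1 ⁻¹' s) :=
      (Kernel.measurable_kernel_prodMk_left hs).comp measurable_fst
    rw [← hfst, hlaw, Measure.compProd_apply hs, Measure.fst,
      lintegral_map (Kernel.measurable_kernel_prodMk_left hs) measurable_fst,
      ← lintegral_indicator hE, lintegral_prod _ (hker.indicator hE).aemeasurable,
      Measure.restrict_apply hs, Measure.prod_apply (hs.inter hE)]
    refine lintegral_congr fun b => ?_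
    simp only [hslice]
    rw [lintegral_indicator_const (measurable_prodMk_left hE), Set.preimage_inter,
      ← Measure.restrict_apply (measurable_prodMk_left hs), hκ, Measure.smul_apply, smul_eq_mul,
      mul_comm]

end HasCondDistrib

/-! ### Families of uniform variables -/

section UniformVariables

variable {ι : Type*} [Fintype ι]

/-- The law of a family of independent variables that are uniform on `[0, a]`, as a kernel in `a`.
It is defined by scaling standard uniform variables, which makes it a Markov kernel even for
`a ≤ 0`, where `unif a` is not a probability measure. -/
noncomputable def unifKernel (ι : Type*) [Fintype ι] : Kernel ℝ (ι → ℝ) :=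
  (Kernel.id ×ₖ Kernel.const ℝ (Measure.pi fun _ : ι => unif 1)).map fun q i => q.1 * q.2 i

instance : IsMarkovKernel (unifKernel ι) :=
  Kernel.IsMarkovKernel.map _ (by fun_prop)

theorem unifKernel_apply (a : ℝ) :
    unifKernel ι a = (Measure.pi fun _ : ι => unif 1).map fun z i => a * z i := by
  rw [unifKernel, Kernel.map_apply _ (by fun_prop), Kernel.prod_apply, Kernel.id_apply,
    Kernel.const_apply, Measure.dirac_prod, Measure.map_map (by fun_prop) (by fun_prop)]
  rfl

theorem map_mul_unif_one {a : ℝ} (ha : 0 < a) : (unif 1).map (fun r => a * r) = unif a := by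
  have hpre : (fun r => a * r) ⁻¹' Set.Icc 0 a = Set.Icc 0 1 := by
    rw [Set.preimage_const_mul_Icc₀ _ _ ha, zero_div, div_self ha.ne']
  rw [unif, ProbabilityTheory.cond, unif, ProbabilityTheory.cond, Measure.map_smul, ← hpre,
    ← Measure.restrict_map (measurable_const_mul a) measurableSet_Icc, hpre,
    Real.map_volume_mul_left ha.ne', Measure.restrict_smul, smul_smul, Real.volume_Icc,
    Real.volume_Icc, abs_of_pos (inv_pos.2 ha), ENNReal.ofReal_inv_of_pos ha]
  simp

theorem unifKernel_apply_of_pos {a : ℝ} (ha : 0 < a) :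
    unifKernel ι a = Measure.pi fun _ : ι => unif a := by
  have := isProbabilityMeasure_unif ha
  rw [← map_mul_unif_one ha] at this ⊢
  rw [unifKernel_apply, Measure.pi_map_pi fun _ => (measurable_const_mul a).aemeasurable]

theorem restrict_Iio_unif_one {a : ℝ} (ha : a ≤ 1) :
    (unif 1).restrict (Set.Iio a) = unif 1 (Set.Iio a) • unif a := by
  have hset : (Set.Icc 0 1 ∩ Set.Iio a : Set ℝ) =ᵐ[volume] Set.Icc 0 a := by
    have hIco : Set.Icc 0 1 ∩ Set.Iio a = Set.Ico 0 a := by grind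
    exact hIco ▸ Ico_ae_eq_Icc
  have hcond : (unif 1)[|Set.Iio a] = unif a := by
    rw [unif, cond_cond_eq_cond_inter' measurableSet_Icc measurableSet_Iio (by simp),
      ProbabilityTheory.cond, measure_congr hset, Measure.restrict_congr_set hset]
    rfl
  ext s hs
  rw [Measure.restrict_apply hs, Set.inter_comm, Measure.smul_apply, smul_eq_mul, ← hcond,
    mul_comm, cond_mul_eq_inter measurableSet_Iio]

theorem restrict_cube_pi_unif_one {a : ℝ} (ha : 0 < a) (ha1 : a ≤ 1) :
    (Measure.pi fun _ : ι => unif 1).restrict {z | ∀ i, z i < a} =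
      Measure.pi (fun _ : ι => unif 1) {z | ∀ i, z i < a} • unifKernel ι a := by
  have := isProbabilityMeasure_unif ha
  have hcube : {z : ι → ℝ | ∀ i, z i < a} = Set.pi Set.univ fun _ => Set.Iio a := by
    ext z
    simp
  rw [hcube, Measure.restrict_pi_pi, unifKernel_apply_of_pos ha]
  refine Measure.pi_eq fun s _ => ?_
  simp [restrict_Iio_unif_one ha1, Measure.pi_pi, Finset.prod_mul_distrib]

/-- The law of the sum of `n` independent variables that are uniform on `[0, a]`, as a Markov kernel
in `(a, n)`. -/
noncomputable def unifSumKernel : Kernel (ℝ × ℕ) ℝ where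
  toFun q := (unifKernel (Fin q.2) q.1).map fun z : Fin q.2 → ℝ => ∑ i, z i
  measurable' := measurable_from_prod_countable_left fun n =>
    (Measure.measurable_map (fun z : Fin n → ℝ => ∑ i, z i) (by fun_prop)).comp
      (unifKernel (Fin n)).measurable

instance : IsMarkovKernel unifSumKernel :=
  ⟨fun q => Measure.isProbabilityMeasure_map (μ := unifKernel (Fin q.2) q.1) (by fun_prop)⟩

theorem unifSumKernel_apply (a : ℝ) (n : ℕ) :
    unifSumKernel (a, n) = (unifKernel (Fin n) a).map fun z => ∑ i, z i := rfl

theorem unifSumKernel_apply_of_pos {a : ℝ} (ha : 0 < a) (n : ℕ) :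
    unifSumKernel (a, n) = unifSum a n := by
  rw [unifSumKernel_apply, unifKernel_apply_of_pos ha, unifSum]

theorem map_sum_unifKernel (a : ℝ) :
    (unifKernel ι a).map (fun z => ∑ i, z i) = unifSumKernel (a, Fintype.card ι) := by
  let e := Fintype.equivFin ι
  rw [unifSumKernel_apply, unifKernel_apply, unifKernel_apply,
    ← (measurePreserving_piCongrLeft (fun _ : Fin (Fintype.card ι) => unif 1) e).map_eq,
    Measure.map_map (by fun_prop) (by fun_prop), Measure.map_map (by fun_prop) (by fun_prop),
    Measure.map_map (by fun_prop) (by fun_prop)]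
  congr 1
  funext z
  simp [← e.sum_comp, MeasurableEquiv.coe_piCongrLeft]

end UniformVariables

/-! ### Resampling the weights of a forest -/

/-- The realisation `c` with the weights on `F` erased, that is, replaced by `0`. -/
noncomputable def eraseWeights (F : Finset (List ℕ)) (c : Config) : Config :=
  (c.1, (F : Set (List ℕ))ᶜ.indicator c.2)

/-- The value of the future maximum weight at `u` if `j :: u` is the next backbone vertex. -/
noncomputable def level (u : List ℕ) (j : ℕ) (c : Config) : ℝ :=
  (branchThreshold c.1 c.2 (j :: u)).toReal

/-- The pairs of a realisation with the weights on `F` erased and of a family of weights on `F` for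
which the realisation given by both has the local forest `F`. -/
def acceptanceSet (u : List ℕ) (j : ℕ) (F : Finset (List ℕ)) : Set (Config × (F → ℝ)) :=
  {q | (IsLocalForest q.1.1 q.1.2 u j F ∧ level u j q.1 ∈ Set.Ioc 0 1) ∧
    ∀ v, q.2 v < level u j q.1}

theorem eraseWeights_of_notMem {F : Finset (List ℕ)} {y : List ℕ} (hy : y ∉ F) (c : Config) :
    (eraseWeights F c).2 y = c.2 y :=
  Set.indicator_of_mem (by simpa using hy) _

theorem eraseWeights_of_mem {F : Finset (List ℕ)} {y : List ℕ} (hy : y ∈ F) (c : Config) :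
    (eraseWeights F c).2 y = 0 :=
  Set.indicator_of_notMem (by simpa using hy) _

theorem isDeterminedBy_eraseWeights (F : Finset (List ℕ)) :
    IsDeterminedBy Set.univ (F : Set (List ℕ))ᶜ (eraseWeights F) := fun _ _ hx hw =>
  Prod.ext (Set.eqOn_univ _ _ |>.1 hx) (Set.indicator_congr fun _ hy => hw hy)

@[fun_prop]
theorem measurable_eraseWeights (F : Finset (List ℕ)) : Measurable (eraseWeights F) := by
  refine measurable_fst.prodMk (measurable_pi_lambda _ fun y => ?_)
  by_cases hy : y ∈ F
  · simp [hy]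
  · simpa [hy] using (by fun_prop : Measurable fun c : Config => c.2 y)

@[fun_prop]
theorem measurable_level (u : List ℕ) (j : ℕ) : Measurable (level u j) :=
  (measurable_branchThreshold measurable_fst measurable_snd _).ereal_toReal

theorem measurableSet_acceptanceSet (u : List ℕ) (j : ℕ) (F : Finset (List ℕ)) :
    MeasurableSet (acceptanceSet u j F) := by
  have hlevel : Measurable fun q : Config × (F → ℝ) => level u j q.1 := by fun_prop
  refine measurableSet_setOfPred.2 <| Measurable.and (Measurable.and (by fun_prop) ?_) ?_
  · exact measurableSet_setOfPred.1 (hlevel measurableSet_Ioc)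
  · exact Measurable.forall fun v => Measurable.lt (by fun_prop) hlevel

theorem IsRegular.futureMax_mem_Ioc {x : List ℕ → ℕ} {w : List ℕ → ℝ} (h : IsRegular x w) (k : ℕ) :
    futureMax x w k ∈ Set.Ioc 0 1 := by
  have hmax := h.coe_futureMax k
  constructor
  · have hpos : (0 : EReal) < futureMax x w k := by
      rw [hmax, h.threshold_backbone]
      exact lt_max_of_lt_left (by exact_mod_cast h.pos _)
    exact_mod_cast hpos
  · exact_mod_cast hmax.trans_le (threshold_le_of_forall_le h.one_le_offspring h.le_one _)

theorem IsLocalForest.level_eraseWeights {x : List ℕ → ℕ} {w : List ℕ → ℝ} {u : List ℕ} {j : ℕ}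
    {F : Finset (List ℕ)} (hF : IsLocalForest x w u j F) (h : IsRegular x w) :
    level u j (eraseWeights F (x, w)) = futureMax x w u.length := by
  rw [level, ← EReal.toReal_coe (futureMax x w u.length), h.coe_futureMax_of_isLocalForest hF,
    hF.isOffspringForest.branchThreshold_eq fun y hy => (eraseWeights_of_notMem hy (x, w)).symm]
  rfl

theorem IsRegular.isLocalForest_iff_mem_acceptanceSet {x : List ℕ → ℕ} {w : List ℕ → ℝ}
    (h : IsRegular x w) {u : List ℕ} {j : ℕ} {F : Finset (List ℕ)} :
    IsLocalForest x w u j F ↔ (eraseWeights F (x, w), fun v : F => w v) ∈ acceptanceSet u j F := by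
  have herase : ∀ y ∉ F, (eraseWeights F (x, w)).2 y = w y := fun _ hy =>
    eraseWeights_of_notMem hy (x, w)
  constructor
  · intro hF
    have hbranch := h.coe_futureMax_of_isLocalForest hF
    have hmax := h.futureMax_mem_Ioc u.length
    rw [acceptanceSet, Set.mem_ofPred_eq, hF.level_eraseWeights h]
    refine ⟨⟨hF.resample (fun y hy => (herase y hy).symm) (fun y hy => ?_)
      (h.branchThreshold_lt_top _), hmax⟩, fun v => ?_⟩
    · rw [← hbranch, eraseWeights_of_mem hy]
      exact_mod_cast hmax.1
    · rw [← EReal.coe_lt_coe_iff, hbranch]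
      exact hF.isOffspringForest.inner v v.2
  · rintro ⟨⟨hF, hpos, -⟩, hlt⟩
    change 0 < (branchThreshold x (eraseWeights F (x, w)).2 (j :: u)).toReal at hpos
    have hlevel := EReal.coe_toReal (x := branchThreshold x (eraseWeights F (x, w)).2 (j :: u))
      (fun htop => by simp [htop] at hpos) (fun hbot => by simp [hbot] at hpos)
    exact hF.resample herase (fun y hy => hlevel ▸ EReal.coe_lt_coe_iff.2 (hlt ⟨y, hy⟩))
      (hlevel ▸ EReal.coe_lt_top _)

theorem restrict_slice_acceptanceSet (u : List ℕ) (j : ℕ) (F : Finset (List ℕ)) (c : Config) :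
    (Measure.pi fun _ : F => unif 1).restrict (Prod.mk c ⁻¹' acceptanceSet u j F) =
      Measure.pi (fun _ : F => unif 1) (Prod.mk c ⁻¹' acceptanceSet u j F) •
        unifKernel F (level u j c) := by
  by_cases hc : IsLocalForest c.1 c.2 u j F ∧ level u j c ∈ Set.Ioc 0 1
  · have hslice : Prod.mk c ⁻¹' acceptanceSet u j F = {z | ∀ v, z v < level u j c} := by
      simp only [acceptanceSet, Set.preimage_ofPred_eq, hc, true_and]
    rw [hslice, restrict_cube_pi_unif_one hc.2.1 hc.2.2]
  · have hslice : Prod.mk c ⁻¹' acceptanceSet u j F = ∅ := by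
      simp only [acceptanceSet, Set.preimage_ofPred_eq, hc, false_and, Set.ofPred_false]
    simp [hslice]

namespace IsWeightedBPTree

variable {Ω : Type*} [MeasurableSpace Ω] {P : Measure Ω} [IsProbabilityMeasure P] {ν : Measure ℕ}
  [IsProbabilityMeasure ν] {X : Ω → List ℕ → ℕ} {U : Ω → List ℕ → ℝ}
  (h : IsWeightedBPTree P ν X U)
include h

theorem map_weights (F : Finset (List ℕ)) :
    P.map (fun ω (v : F) => U ω v) = Measure.pi fun _ : F => unif 1 := by
  have hindep : iIndepFun (fun (v : F) ω => U ω v) P :=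
    (h.indep.comp (fun _ => Prod.snd) fun _ => measurable_snd).precomp Subtype.val_injective
  simpa only [h.map_weight] using (iIndepFun_iff_map_fun_eq_pi_map
    fun v : F => (h.measurable_weight v).aemeasurable).1 hindep

theorem indepFun_eraseWeights (F : Finset (List ℕ)) :
    IndepFun (fun ω => eraseWeights F (X ω, U ω)) (fun ω (v : F) => U ω v) P :=
  h.indepFun (g := fun c (v : F) => c.2 v) (V' := ∅) (E' := F) (measurable_eraseWeights F)
    (by fun_prop) (isDeterminedBy_eraseWeights F) (fun _ _ _ hw => funext fun v => hw v.2)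
    (Set.disjoint_empty _) disjoint_compl_left

theorem hasCondDistrib_weights_restrict_isLocalForest
    (hreg : ∀ᵐ ω ∂P, IsRegular (X ω) (U ω)) (u : List ℕ) (j : ℕ) (F : Finset (List ℕ)) :
    HasCondDistrib (fun ω (v : F) => U ω v) (fun ω => futureMax (X ω) (U ω) u.length)
      (unifKernel F) (P.restrict {ω | IsLocalForest (X ω) (U ω) u j F}) := by
  have hX := h.measurable_tree
  have hU := h.measurable_weights
  have haccept : {ω | IsLocalForest (X ω) (U ω) u j F} =ᵐ[P]
      {ω | (eraseWeights F (X ω, U ω), fun v : F => U ω v) ∈ acceptanceSet u j F} :=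
    hreg.mono fun ω hω => propext hω.isLocalForest_iff_mem_acceptanceSet
  have hlevel : (fun ω => futureMax (X ω) (U ω) u.length)
      =ᵐ[P.restrict {ω | IsLocalForest (X ω) (U ω) u j F}]
        level u j ∘ fun ω => eraseWeights F (X ω, U ω) := by
    filter_upwards [ae_restrict_of_ae hreg, ae_restrict_mem (measurableSet_setOfPred.2
      (measurable_isLocalForest hX hU u j F))] with ω hω hωF
    exact (hωF.level_eraseWeights hω).symm
  refine hasCondDistrib_congr ?_ hlevel .rfl
  rw [Measure.restrict_congr_set haccept]
  refine HasCondDistrib.comp_right (hf := measurable_level u j) ?_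
  refine hasCondDistrib_restrict_of_indepFun (by fun_prop) (by fun_prop) (h.indepFun_eraseWeights F)
    (measurableSet_acceptanceSet u j F) fun c => ?_
  rw [h.map_weights, Kernel.comap_apply]
  exact restrict_slice_acceptanceSet u j F c

end IsWeightedBPTree

/-! ### Conditioning on the forest -/

theorem forestSize_eq_card {x : List ℕ → ℕ} {w : List ℕ → ℝ} {k : ℕ} {F : Finset (List ℕ)}
    (hF : forest x w k = F) : forestSize x w k = F.card := by
  rw [forestSize, hF, Set.ncard_coe_finset]

namespace IsRegular

variable {x : List ℕ → ℕ} {w : List ℕ → ℝ} (h : IsRegular x w) {k : ℕ} {F : Finset (List ℕ)}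
include h

theorem eq_of_isLocalForest {u u' : List ℕ} {j j' : ℕ} (hlen : u.length = u'.length)
    (hF : IsLocalForest x w u j F) (hF' : IsLocalForest x w u' j' F) : (u, j) = (u', j') := by
  obtain ⟨hu, hju⟩ := h.backbone_eq_of_isLocalForest hF
  obtain ⟨hu', hju'⟩ := h.backbone_eq_of_isLocalForest hF'
  rw [← hu, ← hu', hlen]
  rw [hlen, hju'] at hju
  rw [(List.cons.inj hju).1]

theorem attachedWeight_eq_sum (hF : forest x w k = F) :
    attachedWeight x w k = ∑ v : F, w v := by
  rw [h.attachedWeight_eq, hF, finsum_mem_coe_finset, Finset.sum_coe_sort]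

end IsRegular

section Partition

variable {Ω : Type*} [MeasurableSpace Ω] {P : Measure Ω} {X : Ω → List ℕ → ℕ}
  {U : Ω → List ℕ → ℝ} (hreg : ∀ᵐ ω ∂P, IsRegular (X ω) (U ω))
include hreg

theorem forest_eq_ae_eq_iUnion (k : ℕ) (F : Finset (List ℕ)) :
    {ω | forest (X ω) (U ω) k = F} =ᵐ[P]
      ⋃ q : {q : List ℕ × ℕ // q.1.length = k},
        {ω | IsLocalForest (X ω) (U ω) q.1.1 q.1.2 F} := by
  refine hreg.mono fun ω hω => propext ?_
  refine hω.forest_eq_iff.trans (Iff.trans ?_ Set.mem_iUnion.symm)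
  simp [and_comm]

variable (hX : Measurable X) (hU : Measurable U)
include hX hU

theorem nullMeasurableSet_forest_eq (k : ℕ) (F : Finset (List ℕ)) :
    NullMeasurableSet {ω | forest (X ω) (U ω) k = F} P :=
  (MeasurableSet.iUnion fun _ => measurableSet_setOfPred.2 <|
    measurable_isLocalForest hX hU _ _ F).nullMeasurableSet.congr
    (forest_eq_ae_eq_iUnion hreg k F).symm

theorem restrict_forest_eq_sum (k : ℕ) (F : Finset (List ℕ)) :
    P.restrict {ω | forest (X ω) (U ω) k = F} =
      Measure.sum fun q : {q : List ℕ × ℕ // q.1.length = k} =>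
        P.restrict {ω | IsLocalForest (X ω) (U ω) q.1.1 q.1.2 F} := by
  rw [Measure.restrict_congr_set (forest_eq_ae_eq_iUnion hreg k F)]
  refine Measure.restrict_iUnion_ae (fun q q' hne => ?_) fun q =>
    (measurableSet_setOfPred.2 (measurable_isLocalForest hX hU _ _ F)).nullMeasurableSet
  refine measure_mono_null (fun ω hω (hωreg : IsRegular (X ω) (U ω)) => hne ?_) (ae_iff.1 hreg)
  exact Subtype.ext (hωreg.eq_of_isLocalForest (q.2.trans q'.2.symm) hω.1 hω.2)

theorem sum_restrict_forest_eq (k : ℕ) :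
    Measure.sum (fun F : Finset (List ℕ) => P.restrict {ω | forest (X ω) (U ω) k = F}) = P := by
  rw [← Measure.restrict_iUnion_ae (fun F F' hne => ?_)
    fun F => nullMeasurableSet_forest_eq hreg hX hU k F]
  · exact Measure.restrict_eq_self_of_ae_mem <| hreg.mono fun ω hω => Set.mem_iUnion.2
      ⟨(hω.finite_forest k).toFinset, (hω.finite_forest k).coe_toFinset.symm⟩
  · refine (Set.disjoint_left.2 fun ω hω hω' => hne ?_).aedisjoint
    exact Finset.coe_injective (hω.symm.trans hω')

theorem ae_restrict_forest_eq (k : ℕ) (F : Finset (List ℕ)) :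
    ∀ᵐ ω ∂P.restrict {ω | forest (X ω) (U ω) k = F},
      IsRegular (X ω) (U ω) ∧ forest (X ω) (U ω) k = F :=
  (ae_restrict_of_ae hreg).and (ae_restrict_mem₀ (nullMeasurableSet_forest_eq hreg hX hU k F))

end Partition

namespace IsWeightedBPTree

variable {Ω : Type*} [MeasurableSpace Ω] {P : Measure Ω} [IsProbabilityMeasure P] {ν : Measure ℕ}
  [IsProbabilityMeasure ν] {X : Ω → List ℕ → ℕ} {U : Ω → List ℕ → ℝ}
  (h : IsWeightedBPTree P ν X U) (hreg : ∀ᵐ ω ∂P, IsRegular (X ω) (U ω))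
include h hreg

theorem hasCondDistrib_weights_restrict_forest_eq (k : ℕ) (F : Finset (List ℕ)) :
    HasCondDistrib (fun ω (v : F) => U ω v) (fun ω => futureMax (X ω) (U ω) k)
      (unifKernel F) (P.restrict {ω | forest (X ω) (U ω) k = F}) := by
  rw [restrict_forest_eq_sum hreg h.measurable_tree h.measurable_weights]
  refine hasCondDistrib_sum_measure ?_
  rintro ⟨⟨u, j⟩, rfl⟩
  exact h.hasCondDistrib_weights_restrict_isLocalForest hreg u j F

theorem hasCondDistrib_attachedWeight_restrict_forest_eq (k : ℕ) (F : Finset (List ℕ)) :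
    HasCondDistrib (fun ω => attachedWeight (X ω) (U ω) k)
      (fun ω => (futureMax (X ω) (U ω) k, forestSize (X ω) (U ω) k)) unifSumKernel
      (P.restrict {ω | forest (X ω) (U ω) k = F}) := by
  have hsum := (h.hasCondDistrib_weights_restrict_forest_eq hreg k F).comp_left
    (f := fun z => ∑ v, z v) (by fun_prop)
  have hcard : Measurable fun a : ℝ => (a, F.card) := by fun_prop
  have hker : (unifKernel F).map (fun z => ∑ v, z v) = unifSumKernel.comap _ hcard := by
    ext1 a
    rw [Kernel.map_apply _ (by fun_prop), map_sum_unifKernel, Kernel.comap_apply, Fintype.card_coe]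
  have hforest := ae_restrict_forest_eq hreg h.measurable_tree h.measurable_weights k F
  exact hasCondDistrib_congr (HasCondDistrib.comp_right (hker ▸ hsum))
    (hforest.mono fun ω hω => by simp [forestSize_eq_card hω.2])
    (hforest.mono fun ω hω => hω.1.attachedWeight_eq_sum hω.2)

theorem hasCondDistrib_attachedWeight (k : ℕ) :
    HasCondDistrib (fun ω => attachedWeight (X ω) (U ω) k)
      (fun ω => (futureMax (X ω) (U ω) k, forestSize (X ω) (U ω) k)) unifSumKernel P := by
  rw [← sum_restrict_forest_eq hreg h.measurable_tree h.measurable_weights k]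
  exact hasCondDistrib_sum_measure fun F =>
    h.hasCondDistrib_attachedWeight_restrict_forest_eq hreg k F

theorem aemeasurable_attachedWeight (k : ℕ) :
    AEMeasurable (fun ω => attachedWeight (X ω) (U ω) k) P :=
  (h.hasCondDistrib_attachedWeight hreg k).aemeasurable_snd

theorem aemeasurable_futureMax (k : ℕ) : AEMeasurable (fun ω => futureMax (X ω) (U ω) k) P :=
  (h.hasCondDistrib_attachedWeight hreg k).aemeasurable_fst.fst

theorem aemeasurable_forestSize (k : ℕ) : AEMeasurable (fun ω => forestSize (X ω) (U ω) k) P :=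
  (h.hasCondDistrib_attachedWeight hreg k).aemeasurable_fst.snd

theorem ae_map_futureMax_pos {Q : Measure Ω} (hQ : Q ≪ P) (k : ℕ) :
    ∀ᵐ a ∂Q.map fun ω => futureMax (X ω) (U ω) k, 0 < a := by
  rw [ae_map_iff ((h.aemeasurable_futureMax hreg k).mono_ac hQ) measurableSet_Ioi]
  exact hQ.ae_le (hreg.mono fun ω hω => (hω.futureMax_mem_Ioc k).1)

theorem condDistrib_weights_ae_eq (k : ℕ) (F : Finset (List ℕ)) :
    ∀ᵐ a ∂((P[|{ω | forest (X ω) (U ω) k = F}]).map fun ω => futureMax (X ω) (U ω) k),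
      condDistrib (fun ω (v : F) => U ω v) (fun ω => futureMax (X ω) (U ω) k)
        (P[|{ω | forest (X ω) (U ω) k = F}]) a = Measure.pi fun _ : F => unif a := by
  have hlaw := hasCondDistrib_smul_measure (h.hasCondDistrib_weights_restrict_forest_eq hreg k F)
    (P {ω | forest (X ω) (U ω) k = F})⁻¹
  filter_upwards [condDistrib_ae_eq_of_hasCondDistrib hlaw,
    h.ae_map_futureMax_pos hreg cond_absolutelyContinuous k] with a ha hpos
  exact ha.trans (unifKernel_apply_of_pos hpos)

theorem condDistrib_attachedWeight_ae_eq (k : ℕ) :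
    ∀ᵐ a ∂(P.map fun ω => futureMax (X ω) (U ω) k),
      condDistrib (fun ω => attachedWeight (X ω) (U ω) k) (fun ω => futureMax (X ω) (U ω) k) P a =
        (condDistrib (fun ω => forestSize (X ω) (U ω) k) (fun ω => futureMax (X ω) (U ω) k) P
          a).bind (unifSum a) := by
  have hsize := hasCondDistrib_condDistrib (h.aemeasurable_futureMax hreg k)
    (h.aemeasurable_forestSize hreg k)
  have hlaw := (hasCondDistrib_prodMk hsize (h.hasCondDistrib_attachedWeight hreg k)).snd
  filter_upwards [condDistrib_ae_eq_of_hasCondDistrib hlaw,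
    h.ae_map_futureMax_pos hreg .rfl k] with a ha hpos
  have hsect : ⇑(unifSumKernel.sectR a) = unifSum a := funext (unifSumKernel_apply_of_pos hpos)
  rw [ha, Kernel.snd_apply, Kernel.compProd_apply_eq_compProd_sectR, ← hsect]
  exact Measure.snd_compProd _ _

end IsWeightedBPTree

end InvasionPercolation

theorem lemma1p2_general {Ω : Type*} [MeasurableSpace Ω] (P : Measure Ω) [IsProbabilityMeasure P]
    (ν : Measure ℕ) [IsProbabilityMeasure ν] (hν : ν {0} = 0)
    (X : Ω → List ℕ → ℕ) (U : Ω → List ℕ → ℝ) (hXU : IsWeightedBPTree P ν X U) (k : ℕ) :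
    (∀ᵐ ω ∂P, (∃! b, IsBackbone (X ω) (U ω) b) ∧ (forest (X ω) (U ω) k).Finite) ∧
    AEMeasurable (fun ω => futureMax (X ω) (U ω) k) P ∧
    AEMeasurable (fun ω => forestSize (X ω) (U ω) k) P ∧
    AEMeasurable (fun ω => attachedWeight (X ω) (U ω) k) P ∧
    (∀ F : Finset (List ℕ), NullMeasurableSet {ω | forest (X ω) (U ω) k = F} P) ∧
    (∀ F : Finset (List ℕ),
      ∀ᵐ a ∂((P[|{ω | forest (X ω) (U ω) k = F}]).map fun ω => futureMax (X ω) (U ω) k),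
        condDistrib (fun ω (v : F) => U ω v) (fun ω => futureMax (X ω) (U ω) k)
            (P[|{ω | forest (X ω) (U ω) k = F}]) a =
          Measure.pi fun _ : F => unif a) ∧
    (∀ᵐ a ∂(P.map fun ω => futureMax (X ω) (U ω) k),
      condDistrib (fun ω => attachedWeight (X ω) (U ω) k) (fun ω => futureMax (X ω) (U ω) k) P a =
        (condDistrib (fun ω => forestSize (X ω) (U ω) k) (fun ω => futureMax (X ω) (U ω) k) P
          a).bind (unifSum a)) := by
  have hreg := hXU.ae_isRegular hν
  exact ⟨hreg.mono fun ω hω => ⟨hω.existsUnique_isBackbone, hω.finite_forest k⟩,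
    hXU.aemeasurable_futureMax hreg k, hXU.aemeasurable_forestSize hreg k,
    hXU.aemeasurable_attachedWeight hreg k,
    nullMeasurableSet_forest_eq hreg hXU.measurable_tree hXU.measurable_weights k,
    hXU.condDistrib_weights_ae_eq hreg k, hXU.condDistrib_attachedWeight_ae_eq hreg k⟩

theorem lemma1p2 {Ω : Type*} [MeasurableSpace Ω] (P : Measure Ω) [IsProbabilityMeasure P]
    (ν : Measure ℕ) [IsProbabilityMeasure ν] (α c : ℝ) (hν : IsPowerLawOffspring ν α c)
    (X : Ω → List ℕ → ℕ) (U : Ω → List ℕ → ℝ) (hXU : IsWeightedBPTree P ν X U) (k : ℕ) :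
    -- the objects are almost surely well defined, and they are random variables
    (∀ᵐ ω ∂P, (∃! b, IsBackbone (X ω) (U ω) b) ∧ (forest (X ω) (U ω) k).Finite) ∧
    AEMeasurable (fun ω => futureMax (X ω) (U ω) k) P ∧
    AEMeasurable (fun ω => forestSize (X ω) (U ω) k) P ∧
    AEMeasurable (fun ω => attachedWeight (X ω) (U ω) k) P ∧
    (∀ F : Finset (List ℕ), NullMeasurableSet {ω | forest (X ω) (U ω) k = F} P) ∧
    -- given the forest, and given that the future maximum weight is `a`, the weights of the edges
    -- of the forest are i.i.d. uniform on `[0, a]`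
    (∀ F : Finset (List ℕ),
      ∀ᵐ a ∂((P[|{ω | forest (X ω) (U ω) k = F}]).map fun ω => futureMax (X ω) (U ω) k),
        condDistrib (fun ω (v : F) => U ω v) (fun ω => futureMax (X ω) (U ω) k)
            (P[|{ω | forest (X ω) (U ω) k = F}]) a =
          Measure.pi fun _ : F => unif a) ∧
    -- given that the future maximum weight is `a`, the attached weight has the law of the sum of
    -- `forestSize` uniform variables on `[0, a]`, independent of each other and of `forestSize`
    (∀ᵐ a ∂(P.map fun ω => futureMax (X ω) (U ω) k),
      condDistrib (fun ω => attachedWeight (X ω) (U ω) k) (fun ω => futureMax (X ω) (U ω) k) P a =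
        (condDistrib (fun ω => forestSize (X ω) (U ω) k) (fun ω => futureMax (X ω) (U ω) k) P
          a).bind (unifSum a)) :=
  lemma1p2_general P ν hν.zero_null X U hXU k
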